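/- Let $\mathbb F$ be a field and let $0\neq q\in\mathbb F$ be not a root of unity. Write $[n]_q=\frac{q^n-q^{-n}}{q-q^{-1}}$ for $n\in\mathbb Z$ and $[n]^!_q=[n]_q[n-1]_q\cdots[1]_q$ for $n\in\mathbb N$ (with $[0]^!_q=1$). Let $U_q(\mathfrak{sl}_2)$ be the $\mathbb F$-algebra with generators $e,f,k^{\pm1}$ and relations $kk^{-1}=k^{-1}k=1$, $ke=q^2ek$, $kf=q^{-2}fk$, $ef-fe=\frac{k-k^{-1}}{q-q^{-1}}$. For $d\in\mathbb N$ let $\mathbf V_d$ be the irreducible $U_q(\mathfrak{sl}_2)$-module with basis $v_0,\dots,v_d$ such that $kv_i=q^{d-2i}v_i$, $fv_i=[i+1]_qv_{i+1}$ for $i<d$, $fv_d=0$, $ev_i=[d-i+1]_qv_{i-1}$ for $i\ge1$, $ev_0=0$. For $\lambda\in\mathbb Z$ put $\mathbf V_d(\lambda)=\{v\in\mathbf V_d : kv=q^\lambda v\}$. The Lusztig operators $T,T^\vee$ act on $\mathbf V_d(\lambda)$ as $$T=\sum_{\substack{a,b,c\in\mathbb N\\ b-a-c=\lambda}}\frac{e^af^be^c}{[a]^!_q[b]^!_q[c]^!_q}(-1)^bq^{b-ac},\qquad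 T^\vee=\sum_{\substack{a,b,c\in\mathbb N\\ a-b+c=\lambda}}\frac{f^ae^bf^c}{[a]^!_q[b]^!_q[c]^!_q}(-1)^bq^{b-ac}.$$ Let $\mathcal E$ be the $\mathbb F$-algebra with generators $x,y^{\pm1},z$ and relations $yy^{-1}=y^{-1}y=1$, $\frac{qxy-q^{-1}yx}{q-q^{-1}}=\frac{qyz-q^{-1}zy}{q-q^{-1}}=\frac{qzx-q^{-1}xz}{q-q^{-1}}=1$. For $0\ne\theta\in\mathbb F$ and $t\in\mathbb Z$, the primary identification of type $(\theta,t)$ is the algebra isomorphism $\mathcal E\to U_q(\mathfrak{sl}_2)$ sending $$x\mapsto k^{-1}-k^{-1-t}e\,q^{1+t}(q-q^{-1})\theta^{-1},\quad y^{\pm1}\mapsto k^{\pm1},\quad z\mapsto k^{-1}+fk^t\,q^{-t}(q-q^{-1})\theta,$$ and the secondary identification of type $(\theta,t)$ is the algebra isomorphism $\mathcal E\to U_q(\mathfrak{sl}_2)$ sending $$x\mapsto k-k^{1+t}f\,q^{1+t}(q-q^{-1})\theta^{-1},\quad y^{\pm1}\mapsto k^{\mp1},\quad z\mapsto k+ek^{-t}\,q^{-t}(q-q^{-1})\theta.$$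 Through either of them $\mathcal E$ acts on $\mathbf V_d$. Put $n_x=\frac{q(1-yz)}{q-q^{-1}}$, $n_z=\frac{q(1-xy)}{q-q^{-1}}$ and, for a nilpotent operator $\varphi$, $\exp_q(\varphi)=\sum_{i\in\mathbb N}\frac{q^{\binom i2}}{[i]^!_q}\varphi^i$. Let $Y$ be the operator on $\mathbf V_d$ that acts on the $q^{d-2i}$-eigenspace of $y$ as $q^{2i(d-i)}$ for $0\le i\le d$, let $\Omega=\exp_q(n_x)\,Y\,\exp_q(n_z)$ (the standard rotator), and let $\tau_y=\exp_q(n_z)\,\Omega$. Then, for all $d\in\mathbb N$, $0\neq\theta\in\mathbb F$ and $t\in\mathbb Z$, the operators $T$ and $T^\vee$ are invertible on $\mathbf V_d$, and the following hold on $\mathbf V_d$. (i) If $\theta^2=q$, then under the primary identification of type $(\theta,t)$, $\tau_y=(-1)^d\theta^{d^2}T^{-1}$. (ii) If $\theta^2=q$, then under the secondary identification of type $(\theta,t)$, $\tau_y=(-1)^d\theta^{d^2}(T^\vee)^{-1}$. (iii) If $\theta^2=q^{-1}$, then under the primary identification of type $(\theta,t)$, $\tau_y=\theta^{-d^2}(T^\vee)^{-1}$.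 (iv) If $\theta^2=q^{-1}$, then under the secondary identification of type $(\theta,t)$, $\tau_y=\theta^{-d^2}T^{-1}$. -/

import Mathlib

namespace QuantumSl2

section Relations

variable {F : Type*} [Field F] {A : Type*} [Ring A] [Algebra F A]

/-- `q` is nonzero and not a root of unity. -/
def IsGeneric (q : F) : Prop := q ≠ 0 ∧ ∀ n : ℕ, 0 < n → q ^ n ≠ 1

/-- The quantum integer `[n]_q`. -/
def qInt (q : F) (n : ℤ) : F := (q ^ n - q ^ (-n)) / (q - q⁻¹)

/-- The quantum factorial `[n]_q [n-1]_q ⋯ [1]_q`. -/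
def qFactorial (q : F) (n : ℕ) : F := ∏ i ∈ Finset.range n, qInt q ((i : ℤ) + 1)

/-- The defining relations of the Chevalley presentation, for elements `e`, `f` and an invertible
element `K` of an algebra. -/
structure IsChevalley (q : F) (e f : A) (K : Aˣ) : Prop where
  ke : (K : A) * e = q ^ (2 : ℤ) • (e * (K : A))
  kf : (K : A) * f = q ^ (-2 : ℤ) • (f * (K : A))
  ef : e * f - f * e = (q - q⁻¹)⁻¹ • ((K : A) - ((K⁻¹ : Aˣ) : A))

/-- The defining relations of the equitable presentation, for elements `x`, `z` and an invertible
element `y` of an algebra. -/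
structure IsEquitable (q : F) (x : A) (y : Aˣ) (z : A) : Prop where
  xy : (q - q⁻¹)⁻¹ • (q • (x * (y : A)) - q⁻¹ • ((y : A) * x)) = 1
  yz : (q - q⁻¹)⁻¹ • (q • ((y : A) * z) - q⁻¹ • (z * (y : A))) = 1
  zx : (q - q⁻¹)⁻¹ • (q • (z * x) - q⁻¹ • (x * z)) = 1

theorem IsGeneric.ne_zero {q : F} (hq : IsGeneric q) : q ≠ 0 := hq.1

theorem IsGeneric.sq_sub_one_ne_zero {q : F} (hq : IsGeneric q) : q ^ 2 - 1 ≠ 0 :=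
  sub_ne_zero.2 (hq.2 2 (by norm_num))

theorem IsGeneric.sub_inv_ne_zero {q : F} (hq : IsGeneric q) : q - q⁻¹ ≠ 0 := by
  intro h
  apply hq.sq_sub_one_ne_zero
  have h0 := hq.ne_zero
  have : q * (q - q⁻¹) = q ^ 2 - 1 := by field_simp
  rw [← this, h, mul_zero]

theorem IsGeneric.zpow_injective {q : F} (hq : IsGeneric q) :
    Function.Injective (fun n : ℤ => q ^ n) := by
  have h0 := hq.ne_zero
  have key : ∀ n : ℤ, q ^ n = 1 → n = 0 := by
    intro n hn
    by_contra hne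
    rcases lt_or_gt_of_ne hne with h | h
    · apply hq.2 n.natAbs (by omega)
      rw [← zpow_natCast, show ((n.natAbs : ℕ) : ℤ) = -n by omega, zpow_neg, hn, inv_one]
    · apply hq.2 n.natAbs (by omega)
      rw [← zpow_natCast, show ((n.natAbs : ℕ) : ℤ) = n by omega, hn]
  intro m n h
  have : q ^ (m - n) = 1 := by
    rw [zpow_sub₀ h0]
    simp only at h
    rw [h, div_self (zpow_ne_zero _ h0)]
  have := key _ this
  omega

theorem zpow_mul_of_smul {c : F} (hc : c ≠ 0) (U : Aˣ) (a : A)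
    (h : (U : A) * a = c • (a * (U : A))) (n : ℤ) :
    ((U ^ n : Aˣ) : A) * a = c ^ n • (a * ((U ^ n : Aˣ) : A)) := by
  have hinv : ((U⁻¹ : Aˣ) : A) * a = c⁻¹ • (a * ((U⁻¹ : Aˣ) : A)) := by
    have h1 : ((U⁻¹ : Aˣ) : A) * ((U : A) * a) * ((U⁻¹ : Aˣ) : A)
        = ((U⁻¹ : Aˣ) : A) * (c • (a * (U : A))) * ((U⁻¹ : Aˣ) : A) := by rw [h]
    rw [← mul_assoc, Units.inv_mul, one_mul, mul_smul_comm, smul_mul_assoc, mul_assoc, mul_assoc,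
      Units.mul_inv, mul_one] at h1
    rw [h1, smul_smul, inv_mul_cancel₀ hc, one_smul]
  induction n using Int.induction_on with
  | zero => simp
  | succ n ih =>
    rw [zpow_add_one, Units.val_mul, mul_assoc, h, mul_smul_comm, ← mul_assoc, ih, smul_mul_assoc,
      smul_smul, mul_assoc, zpow_add_one₀ hc, mul_comm]
  | pred n ih =>
    rw [zpow_sub_one, Units.val_mul, mul_assoc, hinv, mul_smul_comm, ← mul_assoc, ih,
      smul_mul_assoc, smul_smul, mul_assoc, zpow_sub_one₀ hc, mul_comm]

theorem IsChevalley.zpow_mul_e {q : F} (hq : q ≠ 0) {e f : A} {K : Aˣ} (h : IsChevalley q e f K)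
    (n : ℤ) : ((K ^ n : Aˣ) : A) * e = q ^ (2 * n) • (e * ((K ^ n : Aˣ) : A)) := by
  rw [zpow_mul]
  exact zpow_mul_of_smul (zpow_ne_zero _ hq) K e h.ke n

theorem IsChevalley.zpow_mul_f {q : F} (hq : q ≠ 0) {e f : A} {K : Aˣ} (h : IsChevalley q e f K)
    (n : ℤ) : ((K ^ n : Aˣ) : A) * f = q ^ (-2 * n) • (f * ((K ^ n : Aˣ) : A)) := by
  rw [zpow_mul]
  exact zpow_mul_of_smul (zpow_ne_zero _ hq) K f h.kf n

/-- The Chevalley relations are preserved by `e ↔ f`, `K ↔ K⁻¹`. -/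
theorem IsChevalley.swap {q : F} (hq : q ≠ 0) {e f : A} {K : Aˣ} (h : IsChevalley q e f K) :
    IsChevalley q f e K⁻¹ where
  ke := by simpa using h.zpow_mul_f hq (-1)
  kf := by simpa using h.zpow_mul_e hq (-1)
  ef := by
    rw [← neg_sub, h.ef, ← smul_neg, neg_sub, inv_inv]

set_option linter.unusedSimpArgs false in
theorem IsChevalley.equitable {q : F} (hq : IsGeneric q) {e f : A} {K : Aˣ}
    (h : IsChevalley q e f K) {θ : F} (hθ : θ ≠ 0) (t : ℤ) :
    IsEquitable q
      (((K⁻¹ : Aˣ) : A) - (q ^ (1 + t) * (q - q⁻¹) * θ⁻¹) • (((K ^ (-1 - t) : Aˣ) : A) * e))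
      K
      (((K⁻¹ : Aˣ) : A) + (q ^ (-t) * (q - q⁻¹) * θ) • (f * ((K ^ t : Aˣ) : A))) := by
  have h0 := hq.ne_zero
  have h1 := hq.sub_inv_ne_zero
  have h2 := hq.sq_sub_one_ne_zero
  obtain ⟨P, hP⟩ : ∃ P : ℤ → A, ∀ n, P n = ((K ^ n : Aˣ) : A) := ⟨_, fun _ => rfl⟩
  have hK : (K : A) = P 1 := by simp [hP]
  have hK' : ((K⁻¹ : Aˣ) : A) = P (-1) := by simp [hP]
  have PP : ∀ m n, P m * P n = P (m + n) := by
    intro m n; rw [hP, hP, hP, ← Units.val_mul, zpow_add]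
  have P0 : P 0 = 1 := by simp [hP]
  have Pe : ∀ n, P n * e = q ^ (2 * n) • (e * P n) := by
    intro n; rw [hP]; exact h.zpow_mul_e h0 n
  have Pf : ∀ n, P n * f = q ^ (-2 * n) • (f * P n) := by
    intro n; rw [hP]; exact h.zpow_mul_f h0 n
  have Pe' : ∀ n w, P n * (e * w) = q ^ (2 * n) • (e * (P n * w)) := by
    intro n w; rw [← mul_assoc, Pe, smul_mul_assoc, mul_assoc]
  have Pf' : ∀ n w, P n * (f * w) = q ^ (-2 * n) • (f * (P n * w)) := by
    intro n w; rw [← mul_assoc, Pf, smul_mul_assoc, mul_assoc]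
  have fe : ∀ w, f * (e * w) = e * (f * w) - (q - q⁻¹)⁻¹ • (P 1 * w - P (-1) * w) := by
    intro w
    have := h.ef
    rw [hK, hK'] at this
    rw [← sub_mul, ← smul_mul_assoc, ← this, sub_mul, mul_assoc, mul_assoc]
    abel
  refine ⟨?_, ?_, ?_⟩
  · rw [hK, hK', ← hP]
    simp only [mul_sub, sub_mul, mul_add, add_mul, smul_mul_assoc, mul_smul_comm, mul_assoc, Pe, Pf,
      Pe', Pf', PP, fe, smul_sub, smul_add, smul_smul]
    ring_nf
    rw [P0]
    match_scalars <;>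
      (try simp only [zpow_add₀ h0, zpow_sub₀ h0, zpow_neg, zpow_mul, zpow_ofNat]) <;>
      field_simp <;> ring
  · rw [hK, hK', ← hP]
    simp only [mul_sub, sub_mul, mul_add, add_mul, smul_mul_assoc, mul_smul_comm, mul_assoc, Pe, Pf,
      Pe', Pf', PP, fe, smul_sub, smul_add, smul_smul]
    ring_nf
    rw [P0]
    match_scalars <;>
      (try simp only [zpow_add₀ h0, zpow_sub₀ h0, zpow_neg, zpow_mul, zpow_ofNat]) <;>
      field_simp <;> ring
  · rw [hK', ← hP, ← hP]
    simp only [mul_sub, sub_mul, mul_add, add_mul, smul_mul_assoc, mul_smul_comm, mul_assoc, Pe, Pf,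
      Pe', Pf', PP, fe, smul_sub, smul_add, smul_smul]
    ring_nf
    rw [P0]
    match_scalars <;>
      (try simp only [zpow_add₀ h0, zpow_sub₀ h0, zpow_neg, zpow_mul, zpow_ofNat]) <;>
      field_simp <;> ring

theorem IsEquitable.chevalley {q : F} (hq : IsGeneric q) {x z : A} {y : Aˣ}
    (h : IsEquitable q x y z) {θ : F} (hθ : θ ≠ 0) (t : ℤ) :
    IsChevalley q
      ((q ^ (-1 - t) * (q - q⁻¹)⁻¹ * θ) • (((y ^ t : Aˣ) : A) * (1 - (y : A) * x)))
      ((q ^ t * (q - q⁻¹)⁻¹ * θ⁻¹) • ((z - ((y⁻¹ : Aˣ) : A)) * ((y ^ (-t) : Aˣ) : A)))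
      y := by
  have h0 := hq.ne_zero
  have h1 := hq.sub_inv_ne_zero
  have h2 := hq.sq_sub_one_ne_zero
  have r : ∀ {a b : A}, (q - q⁻¹)⁻¹ • (q • a - q⁻¹ • b) = 1 →
      b = q ^ (2 : ℤ) • a - (q ^ (2 : ℤ) - 1) • (1 : A) := by
    intro a b hab
    rw [← hab]
    match_scalars <;> (simp only [zpow_ofNat]; field_simp; try ring)
  have yx : (y : A) * x = q ^ (2 : ℤ) • (x * (y : A)) - (q ^ (2 : ℤ) - 1) • (1 : A) := r h.xy
  have zy : z * (y : A) = q ^ (2 : ℤ) • ((y : A) * z) - (q ^ (2 : ℤ) - 1) • (1 : A) := r h.yz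
  have xz : x * z = q ^ (2 : ℤ) • (z * x) - (q ^ (2 : ℤ) - 1) • (1 : A) := r h.zx
  obtain ⟨N, hN⟩ : ∃ N : A, N = 1 - (y : A) * x := ⟨_, rfl⟩
  obtain ⟨M, hM⟩ : ∃ M : A, M = z - ((y⁻¹ : Aˣ) : A) := ⟨_, rfl⟩
  have yN : (y : A) * N = q ^ (2 : ℤ) • (N * (y : A)) := by
    have : N = q ^ (2 : ℤ) • (1 - x * (y : A)) := by
      rw [hN, yx]; module
    rw [this, smul_mul_assoc, smul_smul]
    conv_rhs => rw [← smul_smul, ← smul_mul_assoc, ← this, hN]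
    rw [mul_smul_comm]
    congr 1
    noncomm_ring
  have yM : (y : A) * M = q ^ (-2 : ℤ) • (M * (y : A)) := by
    rw [hM, mul_sub, sub_mul, Units.mul_inv, Units.inv_mul, zy]
    match_scalars <;> (simp only [zpow_neg]; field_simp; try ring)
  have NM : N * M - M * N = (q ^ (2 : ℤ) - 1) • ((y : A) - ((y⁻¹ : Aˣ) : A)) := by
    have t1 : z * ((y : A) * x) =
        q ^ (2 : ℤ) • ((y : A) * (z * x)) - (q ^ (2 : ℤ) - 1) • x := by
      rw [← mul_assoc, zy, sub_mul, smul_mul_assoc, smul_mul_assoc, one_mul, mul_assoc]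
    have t2 : (y : A) * x * z =
        q ^ (2 : ℤ) • ((y : A) * (z * x)) - (q ^ (2 : ℤ) - 1) • (y : A) := by
      rw [mul_assoc, xz, mul_sub, mul_smul_comm, mul_smul_comm, mul_one]
    have t3 : (y : A) * x * ((y⁻¹ : Aˣ) : A) =
        q ^ (2 : ℤ) • x - (q ^ (2 : ℤ) - 1) • ((y⁻¹ : Aˣ) : A) := by
      rw [yx, sub_mul, smul_mul_assoc, smul_mul_assoc, one_mul, mul_assoc, Units.mul_inv, mul_one]
    have t4 : ((y⁻¹ : Aˣ) : A) * ((y : A) * x) = x := by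
      rw [← mul_assoc, Units.inv_mul, one_mul]
    rw [hN, hM, sub_mul, mul_sub, mul_sub, sub_mul, mul_sub, one_mul, one_mul, mul_one, mul_sub,
      mul_one, t1, t2, t3, t4]
    module
  rw [← hN, ← hM]
  have YN := zpow_mul_of_smul (zpow_ne_zero 2 h0) y N yN
  have YM := zpow_mul_of_smul (zpow_ne_zero (-2) h0) y M yM
  have YY : ∀ n : ℤ, ((y ^ n : Aˣ) : A) * ((y ^ (-n) : Aˣ) : A) = 1 := by
    intro n; rw [← Units.val_mul, ← zpow_add]; simp
  have YY' : ∀ n : ℤ, ((y ^ (-n) : Aˣ) : A) * ((y ^ n : Aˣ) : A) = 1 := by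
    intro n; rw [← Units.val_mul, ← zpow_add]; simp
  have yc : ∀ n : ℤ, (y : A) * ((y ^ n : Aˣ) : A) = ((y ^ n : Aˣ) : A) * (y : A) := by
    intro n; rw [← Units.val_mul, ← Units.val_mul, (Commute.self_zpow y n).eq]
  refine ⟨?_, ?_, ?_⟩
  · rw [mul_smul_comm, ← mul_assoc, yc, mul_assoc _ (y : A) N, yN, smul_mul_assoc, mul_smul_comm,
      mul_assoc _ N, smul_comm]
  · rw [mul_smul_comm, ← mul_assoc, yM, smul_mul_assoc, smul_mul_assoc, mul_assoc M, yc,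
      ← mul_assoc M, smul_comm]
  · have e1 : ((y ^ t : Aˣ) : A) * N * (M * ((y ^ (-t) : Aˣ) : A)) = N * M := by
      rw [YN t, smul_mul_assoc, mul_assoc, ← mul_assoc _ M, YM t, smul_mul_assoc, mul_smul_comm,
        smul_smul, mul_assoc M, YY, mul_one, ← zpow_mul, ← zpow_mul, ← zpow_add₀ h0]
      simp
    have e2 : M * ((y ^ (-t) : Aˣ) : A) * (((y ^ t : Aˣ) : A) * N) = M * N := by
      rw [mul_assoc, ← mul_assoc _ _ N, YY', one_mul]
    rw [smul_mul_smul_comm, smul_mul_smul_comm, e1, e2, mul_comm (q ^ t * _ * _), ← smul_sub, NM,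
      smul_smul]
    congr 1
    rw [zpow_sub₀ h0]
    simp only [zpow_neg, zpow_ofNat]
    field_simp

end Relations

section Algebras

variable {F : Type*} [Field F]

/-- Names of the Chevalley generators. -/
inductive ChevalleyGen
  | e | f | k | kinv

/-- Names of the equitable generators. -/
inductive EquitableGen
  | x | y | yinv | z

open FreeAlgebra in
/-- The relations of the Chevalley presentation. -/
inductive ChevalleyRel (q : F) :
    FreeAlgebra F ChevalleyGen → FreeAlgebra F ChevalleyGen → Prop
  | k_kinv : ChevalleyRel q (ι F .k * ι F .kinv) 1
  | kinv_k : ChevalleyRel q (ι F .kinv * ι F .k) 1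
  | ke : ChevalleyRel q (ι F .k * ι F .e) (q ^ (2 : ℤ) • (ι F .e * ι F .k))
  | kf : ChevalleyRel q (ι F .k * ι F .f) (q ^ (-2 : ℤ) • (ι F .f * ι F .k))
  | ef : ChevalleyRel q (ι F .e * ι F .f - ι F .f * ι F .e)
      ((q - q⁻¹)⁻¹ • (ι F .k - ι F .kinv))

open FreeAlgebra in
/-- The relations of the equitable presentation. -/
inductive EquitableRel (q : F) :
    FreeAlgebra F EquitableGen → FreeAlgebra F EquitableGen → Prop
  | y_yinv : EquitableRel q (ι F .y * ι F .yinv) 1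
  | yinv_y : EquitableRel q (ι F .yinv * ι F .y) 1
  | xy : EquitableRel q
      ((q - q⁻¹)⁻¹ • (q • (ι F .x * ι F .y) - q⁻¹ • (ι F .y * ι F .x))) 1
  | yz : EquitableRel q
      ((q - q⁻¹)⁻¹ • (q • (ι F .y * ι F .z) - q⁻¹ • (ι F .z * ι F .y))) 1
  | zx : EquitableRel q
      ((q - q⁻¹)⁻¹ • (q • (ι F .z * ι F .x) - q⁻¹ • (ι F .x * ι F .z))) 1

/-- The algebra `U_q(sl₂)` in the Chevalley presentation. -/
abbrev Uq (q : F) : Type _ := RingQuot (ChevalleyRel q)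

/-- The algebra given by the equitable presentation. -/
abbrev UqEquitable (q : F) : Type _ := RingQuot (EquitableRel q)

namespace Uq

/-- The class of a Chevalley generator in `U_q(sl₂)`. -/
noncomputable def gen (q : F) (g : ChevalleyGen) : Uq q :=
  RingQuot.mkAlgHom F (ChevalleyRel q) (FreeAlgebra.ι F g)

/-- The Chevalley generator `e`. -/
noncomputable def e (q : F) : Uq q := gen q .e

/-- The Chevalley generator `f`. -/
noncomputable def f (q : F) : Uq q := gen q .f

/-- The Chevalley generator `k`, as an invertible element with inverse `k⁻¹`. -/
noncomputable def k (q : F) : (Uq q)ˣ where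
  val := gen q .k
  inv := gen q .kinv
  val_inv := by
    simpa [gen] using RingQuot.mkAlgHom_rel F (ChevalleyRel.k_kinv (q := q))
  inv_val := by
    simpa [gen] using RingQuot.mkAlgHom_rel F (ChevalleyRel.kinv_k (q := q))

theorem isChevalley (q : F) : IsChevalley q (e q) (f q) (k q) where
  ke := by simpa [gen, e, k] using RingQuot.mkAlgHom_rel F (ChevalleyRel.ke (q := q))
  kf := by simpa [gen, f, k] using RingQuot.mkAlgHom_rel F (ChevalleyRel.kf (q := q))
  ef := by simpa [gen, e, f, k] using RingQuot.mkAlgHom_rel F (ChevalleyRel.ef (q := q))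

/-- The homomorphism out of `U_q(sl₂)` determined by images of the generators. -/
noncomputable def lift {q : F} {A : Type*} [Ring A] [Algebra F A] {e' f' : A} {K : Aˣ}
    (h : IsChevalley q e' f' K) : Uq q →ₐ[F] A :=
  RingQuot.liftAlgHom F ⟨FreeAlgebra.lift F fun g => match g with
      | .e => e'
      | .f => f'
      | .k => (K : A)
      | .kinv => ((K⁻¹ : Aˣ) : A), by
    intro a b hab
    cases hab
    · simp
    · simp
    · simpa using h.ke
    · simpa using h.kf
    · simpa using h.ef⟩

section

variable {q : F} {A : Type*} [Ring A] [Algebra F A] {e' f' : A} {K : Aˣ}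
  (h : IsChevalley q e' f' K)

theorem lift_e : lift h (e q) = e' := by simp [lift, e, gen]

theorem lift_f : lift h (f q) = f' := by simp [lift, f, gen]

theorem lift_k : lift h (k q : Uq q) = (K : A) := by simp [lift, k, gen]

theorem map_lift_k : Units.map (lift h : Uq q →* A) (k q) = K := by
  ext; exact lift_k h

end

theorem hom_ext {q : F} {A : Type*} [Ring A] [Algebra F A] {g h : Uq q →ₐ[F] A}
    (he : g (e q) = h (e q)) (hf : g (f q) = h (f q)) (hk : g (k q : Uq q) = h (k q : Uq q)) :
    g = h := by
  have hu : Units.map (g : Uq q →* A) (k q) = Units.map (h : Uq q →* A) (k q) := by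
    ext; exact hk
  have hkinv : g ((k q)⁻¹ : (Uq q)ˣ) = h ((k q)⁻¹ : (Uq q)ˣ) := by
    have := congrArg (fun u : Aˣ => ((u⁻¹ : Aˣ) : A)) hu
    simpa [← map_inv] using this
  apply RingQuot.ringQuot_ext' F
  ext i
  cases i
  · exact he
  · exact hf
  · exact hk
  · exact hkinv

end Uq

namespace UqEquitable

/-- The class of an equitable generator. -/
noncomputable def gen (q : F) (g : EquitableGen) : UqEquitable q :=
  RingQuot.mkAlgHom F (EquitableRel q) (FreeAlgebra.ι F g)

/-- The equitable generator `x`. -/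
noncomputable def x (q : F) : UqEquitable q := gen q .x

/-- The equitable generator `z`. -/
noncomputable def z (q : F) : UqEquitable q := gen q .z

/-- The equitable generator `y`, as an invertible element with inverse `y⁻¹`. -/
noncomputable def y (q : F) : (UqEquitable q)ˣ where
  val := gen q .y
  inv := gen q .yinv
  val_inv := by
    simpa [gen] using RingQuot.mkAlgHom_rel F (EquitableRel.y_yinv (q := q))
  inv_val := by
    simpa [gen] using RingQuot.mkAlgHom_rel F (EquitableRel.yinv_y (q := q))

theorem isEquitable (q : F) : IsEquitable q (x q) (y q) (z q) where
  xy := by simpa [gen, x, y] using RingQuot.mkAlgHom_rel F (EquitableRel.xy (q := q))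
  yz := by simpa [gen, z, y] using RingQuot.mkAlgHom_rel F (EquitableRel.yz (q := q))
  zx := by simpa [gen, x, z] using RingQuot.mkAlgHom_rel F (EquitableRel.zx (q := q))

/-- The homomorphism out of the equitable algebra determined by images of the generators. -/
noncomputable def lift {q : F} {A : Type*} [Ring A] [Algebra F A] {x' z' : A} {Y : Aˣ}
    (h : IsEquitable q x' Y z') : UqEquitable q →ₐ[F] A :=
  RingQuot.liftAlgHom F ⟨FreeAlgebra.lift F fun g => match g with
      | .x => x'
      | .y => (Y : A)
      | .yinv => ((Y⁻¹ : Aˣ) : A)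
      | .z => z', by
    intro a b hab
    cases hab
    · simp
    · simp
    · simpa using h.xy
    · simpa using h.yz
    · simpa using h.zx⟩

section

variable {q : F} {A : Type*} [Ring A] [Algebra F A] {x' z' : A} {Y : Aˣ}
  (h : IsEquitable q x' Y z')

theorem lift_x : lift h (x q) = x' := by simp [lift, x, gen]

theorem lift_z : lift h (z q) = z' := by simp [lift, z, gen]

theorem lift_y : lift h (y q : UqEquitable q) = (Y : A) := by simp [lift, y, gen]

theorem map_lift_y : Units.map (lift h : UqEquitable q →* A) (y q) = Y := by
  ext; exact lift_y h

end

theorem hom_ext {q : F} {A : Type*} [Ring A] [Algebra F A] {g h : UqEquitable q →ₐ[F] A}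
    (hx : g (x q) = h (x q)) (hy : g (y q : UqEquitable q) = h (y q : UqEquitable q))
    (hz : g (z q) = h (z q)) : g = h := by
  have hu : Units.map (g : UqEquitable q →* A) (y q) =
      Units.map (h : UqEquitable q →* A) (y q) := by
    ext; exact hy
  have hyinv : g ((y q)⁻¹ : (UqEquitable q)ˣ) = h ((y q)⁻¹ : (UqEquitable q)ˣ) := by
    have := congrArg (fun u : Aˣ => ((u⁻¹ : Aˣ) : A)) hu
    simpa [← map_inv] using this
  apply RingQuot.ringQuot_ext' F
  ext i
  cases i
  · exact hx
  · exact hy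
  · exact hyinv
  · exact hz

/-- `n_x = q (1 - y z) / (q - q⁻¹)`. -/
noncomputable def nx (q : F) : UqEquitable q :=
  (q / (q - q⁻¹)) • (1 - (y q : UqEquitable q) * z q)

/-- `n_z = q (1 - x y) / (q - q⁻¹)`. -/
noncomputable def nz (q : F) : UqEquitable q :=
  (q / (q - q⁻¹)) • (1 - x q * (y q : UqEquitable q))

end UqEquitable

end Algebras

section Identifications

variable {F : Type*} [Field F]

/-- The homomorphism `x ↦ k⁻¹ - k^(-1-t) e q^(1+t) (q - q⁻¹) θ⁻¹`, `y ↦ k`,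
`z ↦ k⁻¹ + f k^t q^(-t) (q - q⁻¹) θ`. -/
noncomputable def primaryHom {q : F} (hq : IsGeneric q) {θ : F} (hθ : θ ≠ 0) (t : ℤ) :
    UqEquitable q →ₐ[F] Uq q :=
  UqEquitable.lift
    (x' := (((Uq.k q)⁻¹ : (Uq q)ˣ) : Uq q) -
      (q ^ (1 + t) * (q - q⁻¹) * θ⁻¹) • (((Uq.k q ^ (-1 - t) : (Uq q)ˣ) : Uq q) * Uq.e q))
    (Y := Uq.k q)
    (z' := (((Uq.k q)⁻¹ : (Uq q)ˣ) : Uq q) +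
      (q ^ (-t) * (q - q⁻¹) * θ) • (Uq.f q * ((Uq.k q ^ t : (Uq q)ˣ) : Uq q)))
    ((Uq.isChevalley q).equitable hq hθ t)

/-- The homomorphism `e ↦ y^t (1 - y x) q^(-1-t) (q - q⁻¹)⁻¹ θ`,
`f ↦ (z - y⁻¹) y^(-t) q^t (q - q⁻¹)⁻¹ θ⁻¹`, `k ↦ y`. -/
noncomputable def primaryInvHom {q : F} (hq : IsGeneric q) {θ : F} (hθ : θ ≠ 0) (t : ℤ) :
    Uq q →ₐ[F] UqEquitable q :=
  Uq.lift ((UqEquitable.isEquitable q).chevalley hq hθ t)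

/-- The homomorphism `x ↦ k - k^(1+t) f q^(1+t) (q - q⁻¹) θ⁻¹`, `y ↦ k⁻¹`,
`z ↦ k + e k^(-t) q^(-t) (q - q⁻¹) θ`. -/
noncomputable def secondaryHom {q : F} (hq : IsGeneric q) {θ : F} (hθ : θ ≠ 0) (t : ℤ) :
    UqEquitable q →ₐ[F] Uq q :=
  UqEquitable.lift
    (x' := (Uq.k q : Uq q) -
      (q ^ (1 + t) * (q - q⁻¹) * θ⁻¹) • (((Uq.k q ^ (1 + t) : (Uq q)ˣ) : Uq q) * Uq.f q))
    (Y := (Uq.k q)⁻¹)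
    (z' := (Uq.k q : Uq q) +
      (q ^ (-t) * (q - q⁻¹) * θ) • (Uq.e q * ((Uq.k q ^ (-t) : (Uq q)ˣ) : Uq q)))
    (by
      have h := ((Uq.isChevalley q).swap hq.ne_zero).equitable hq hθ t
      rwa [inv_inv, inv_zpow', inv_zpow', show -(-1 - t) = 1 + t by ring] at h)

/-- The homomorphism `e ↦ (z - y⁻¹) y^(-t) q^t (q - q⁻¹)⁻¹ θ⁻¹`,
`f ↦ y^t (1 - y x) q^(-1-t) (q - q⁻¹)⁻¹ θ`, `k ↦ y⁻¹`. -/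
noncomputable def secondaryInvHom {q : F} (hq : IsGeneric q) {θ : F} (hθ : θ ≠ 0) (t : ℤ) :
    Uq q →ₐ[F] UqEquitable q :=
  Uq.lift (((UqEquitable.isEquitable q).chevalley hq hθ t).swap hq.ne_zero)

theorem map_units_zpow {A B : Type*} [Ring A] [Ring B] [Algebra F A] [Algebra F B]
    (g : A →ₐ[F] B) {u : Aˣ} {v : Bˣ} (h : g (u : A) = (v : B)) (n : ℤ) :
    g ((u ^ n : Aˣ) : A) = ((v ^ n : Bˣ) : B) := by
  have : Units.map (g : A →* B) u = v := by ext; exact h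
  rw [← this, ← map_zpow]
  rfl

theorem map_units_inv {A B : Type*} [Ring A] [Ring B] [Algebra F A] [Algebra F B]
    (g : A →ₐ[F] B) {u : Aˣ} {v : Bˣ} (h : g (u : A) = (v : B)) :
    g ((u⁻¹ : Aˣ) : A) = ((v⁻¹ : Bˣ) : B) := by
  simpa using map_units_zpow g h (-1)

theorem scalar_aux {q θ : F} (hq : IsGeneric q) (hθ : θ ≠ 0) (t : ℤ) :
    (q ^ (-1 - t) * (q - q⁻¹)⁻¹ * θ) * (q ^ (1 + t) * (q - q⁻¹) * θ⁻¹) = 1 ∧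
    (q ^ t * (q - q⁻¹)⁻¹ * θ⁻¹) * (q ^ (-t) * (q - q⁻¹) * θ) = 1 := by
  have h0 := hq.ne_zero
  have h1 := hq.sub_inv_ne_zero
  have e1 : q ^ (-1 - t) * q ^ (1 + t) = 1 := by rw [← zpow_add₀ h0]; simp
  have e2 : q ^ t * q ^ (-t) = 1 := by rw [← zpow_add₀ h0]; simp
  constructor
  · calc _ = (q ^ (-1 - t) * q ^ (1 + t)) * ((q - q⁻¹)⁻¹ * (q - q⁻¹)) * (θ * θ⁻¹) := by ring
      _ = 1 := by rw [e1, inv_mul_cancel₀ h1, mul_inv_cancel₀ hθ]; simp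
  · calc _ = (q ^ t * q ^ (-t)) * ((q - q⁻¹)⁻¹ * (q - q⁻¹)) * (θ * θ⁻¹) := by ring
      _ = 1 := by rw [e2, inv_mul_cancel₀ h1, mul_inv_cancel₀ hθ]; simp

theorem units_aux {A : Type*} [Ring A] (K : Aˣ) (t : ℤ) (a : A) :
    ((K ^ t : Aˣ) : A) * ((K : A) * (((K ^ (-1 - t) : Aˣ) : A) * a)) = a ∧
    (K : A) * (((K ^ (-1 - t) : Aˣ) : A) * (((K ^ t : Aˣ) : A) * a)) = a ∧
    a * ((K ^ t : Aˣ) : A) * ((K ^ (-t) : Aˣ) : A) = a ∧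
    a * ((K ^ (-t) : Aˣ) : A) * ((K ^ t : Aˣ) : A) = a ∧
    (((K ^ (-1 - t) : Aˣ) : A) * (((K ^ t : Aˣ) : A) * a)) = ((K⁻¹ : Aˣ) : A) * a := by
  have h1 : K ^ t * K * K ^ (-1 - t) = 1 := by group
  have h2 : K * K ^ (-1 - t) * K ^ t = 1 := by group
  have h3 : K ^ (-1 - t) * K ^ t = K⁻¹ := by group
  refine ⟨?_, ?_, ?_, ?_, ?_⟩
  · rw [← mul_assoc, ← mul_assoc, ← Units.val_mul, ← Units.val_mul, h1, Units.val_one, one_mul]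
  · rw [← mul_assoc, ← mul_assoc, ← Units.val_mul, ← Units.val_mul, h2, Units.val_one, one_mul]
  · rw [mul_assoc, ← Units.val_mul, ← zpow_add]; simp
  · rw [mul_assoc, ← Units.val_mul, ← zpow_add]; simp
  · rw [← mul_assoc, ← Units.val_mul, h3]

theorem roundtrip_chevalley {A : Type*} [Ring A] [Algebra F A] {q θ : F} (hq : IsGeneric q)
    (hθ : θ ≠ 0) (t : ℤ) (e f : A) (K : Aˣ) :
    (q ^ (-1 - t) * (q - q⁻¹)⁻¹ * θ) • (((K ^ t : Aˣ) : A) * (1 - (K : A) *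
      (((K⁻¹ : Aˣ) : A) -
        (q ^ (1 + t) * (q - q⁻¹) * θ⁻¹) • (((K ^ (-1 - t) : Aˣ) : A) * e)))) = e ∧
    (q ^ t * (q - q⁻¹)⁻¹ * θ⁻¹) • ((((K⁻¹ : Aˣ) : A) +
      (q ^ (-t) * (q - q⁻¹) * θ) • (f * ((K ^ t : Aˣ) : A)) - ((K⁻¹ : Aˣ) : A)) *
        ((K ^ (-t) : Aˣ) : A)) = f := by
  constructor
  · rw [mul_sub (K : A), Units.mul_inv, sub_sub_cancel, mul_smul_comm, mul_smul_comm, smul_smul,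
      (units_aux K t e).1, (scalar_aux hq hθ t).1, one_smul]
  · rw [add_sub_cancel_left, smul_mul_assoc, smul_smul, (units_aux K t f).2.2.1,
      (scalar_aux hq hθ t).2, one_smul]

theorem roundtrip_equitable {A : Type*} [Ring A] [Algebra F A] {q θ : F} (hq : IsGeneric q)
    (hθ : θ ≠ 0) (t : ℤ) (x z : A) (y : Aˣ) :
    ((y⁻¹ : Aˣ) : A) - (q ^ (1 + t) * (q - q⁻¹) * θ⁻¹) • (((y ^ (-1 - t) : Aˣ) : A) *
      ((q ^ (-1 - t) * (q - q⁻¹)⁻¹ * θ) • (((y ^ t : Aˣ) : A) * (1 - (y : A) * x)))) = x ∧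
    ((y⁻¹ : Aˣ) : A) + (q ^ (-t) * (q - q⁻¹) * θ) •
      (((q ^ t * (q - q⁻¹)⁻¹ * θ⁻¹) • ((z - ((y⁻¹ : Aˣ) : A)) * ((y ^ (-t) : Aˣ) : A))) *
        ((y ^ t : Aˣ) : A)) = z := by
  constructor
  · rw [mul_smul_comm, smul_smul, mul_comm (q ^ (1 + t) * _ * _), (scalar_aux hq hθ t).1, one_smul,
      (units_aux y t _).2.2.2.2, mul_sub, mul_one, ← mul_assoc, Units.inv_mul, one_mul,
      sub_sub_cancel]
  · rw [smul_mul_assoc, smul_smul, mul_comm (q ^ (-t) * _ * _), (scalar_aux hq hθ t).2, one_smul,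
      (units_aux y t _).2.2.2.1, add_sub_cancel]

/-- The primary identification of type `(θ, t)`. -/
noncomputable def primary {q : F} (hq : IsGeneric q) {θ : F} (hθ : θ ≠ 0) (t : ℤ) :
    UqEquitable q ≃ₐ[F] Uq q :=
  AlgEquiv.ofAlgHom (primaryHom hq hθ t) (primaryInvHom hq hθ t)
    (by
      have hy : primaryHom hq hθ t (UqEquitable.y q : UqEquitable q) = (Uq.k q : Uq q) :=
        UqEquitable.lift_y _
      have hx := UqEquitable.lift_x ((Uq.isChevalley q).equitable hq hθ t)
      have hz := UqEquitable.lift_z ((Uq.isChevalley q).equitable hq hθ t)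
      change primaryHom hq hθ t _ = _ at hx
      change primaryHom hq hθ t _ = _ at hz
      obtain ⟨r1, r2⟩ := roundtrip_chevalley hq hθ t (Uq.e q) (Uq.f q) (Uq.k q)
      apply Uq.hom_ext
      · rw [AlgHom.comp_apply, primaryInvHom, Uq.lift_e, map_smul, map_mul, map_sub, map_mul,
          map_one, map_units_zpow _ hy, hy, hx, r1, AlgHom.id_apply]
      · rw [AlgHom.comp_apply, primaryInvHom, Uq.lift_f, map_smul, map_mul, map_sub,
          map_units_zpow _ hy, map_units_inv _ hy, hz, r2, AlgHom.id_apply]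
      · rw [AlgHom.comp_apply, primaryInvHom, Uq.lift_k, hy, AlgHom.id_apply])
    (by
      have hk : primaryInvHom hq hθ t (Uq.k q : Uq q) = (UqEquitable.y q : UqEquitable q) :=
        Uq.lift_k _
      have he := Uq.lift_e ((UqEquitable.isEquitable q).chevalley hq hθ t)
      have hf := Uq.lift_f ((UqEquitable.isEquitable q).chevalley hq hθ t)
      change primaryInvHom hq hθ t _ = _ at he
      change primaryInvHom hq hθ t _ = _ at hf
      obtain ⟨r1, r2⟩ := roundtrip_equitable hq hθ t (UqEquitable.x q) (UqEquitable.z q)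
        (UqEquitable.y q)
      apply UqEquitable.hom_ext
      · rw [AlgHom.comp_apply, primaryHom, UqEquitable.lift_x, map_sub, map_smul, map_mul,
          map_units_zpow _ hk, map_units_inv _ hk, he, r1, AlgHom.id_apply]
      · rw [AlgHom.comp_apply, primaryHom, UqEquitable.lift_y, hk, AlgHom.id_apply]
      · rw [AlgHom.comp_apply, primaryHom, UqEquitable.lift_z, map_add, map_smul, map_mul,
          map_units_zpow _ hk, map_units_inv _ hk, hf, r2, AlgHom.id_apply])

/-- The secondary identification of type `(θ, t)`. -/
noncomputable def secondary {q : F} (hq : IsGeneric q) {θ : F} (hθ : θ ≠ 0) (t : ℤ) :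
    UqEquitable q ≃ₐ[F] Uq q :=
  AlgEquiv.ofAlgHom (secondaryHom hq hθ t) (secondaryInvHom hq hθ t)
    (by
      have hy : secondaryHom hq hθ t (UqEquitable.y q : UqEquitable q) =
          (((Uq.k q)⁻¹ : (Uq q)ˣ) : Uq q) := UqEquitable.lift_y _
      have hx : secondaryHom hq hθ t (UqEquitable.x q) = _ := UqEquitable.lift_x _
      have hz : secondaryHom hq hθ t (UqEquitable.z q) = _ := UqEquitable.lift_z _
      obtain ⟨r1, r2⟩ := roundtrip_chevalley hq hθ t (Uq.f q) (Uq.e q) (Uq.k q)⁻¹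
      rw [inv_inv, inv_zpow', inv_zpow', neg_neg] at r2
      rw [inv_inv, inv_zpow', inv_zpow', show -(-1 - t) = 1 + t by ring] at r1
      apply Uq.hom_ext
      · rw [AlgHom.comp_apply, secondaryInvHom, Uq.lift_e, map_smul, map_mul, map_sub,
          map_units_zpow _ hy, map_units_inv _ hy, hz, inv_inv, inv_zpow', neg_neg, r2,
          AlgHom.id_apply]
      · rw [AlgHom.comp_apply, secondaryInvHom, Uq.lift_f, map_smul, map_mul, map_sub, map_mul,
          map_one, map_units_zpow _ hy, hy, hx, inv_zpow', r1, AlgHom.id_apply]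
      · rw [AlgHom.comp_apply, secondaryInvHom, Uq.lift_k, map_units_inv _ hy, inv_inv,
          AlgHom.id_apply])
    (by
      have hk : secondaryInvHom hq hθ t (Uq.k q : Uq q) =
          (((UqEquitable.y q)⁻¹ : (UqEquitable q)ˣ) : UqEquitable q) := Uq.lift_k _
      have he : secondaryInvHom hq hθ t (Uq.e q) = _ := Uq.lift_e _
      have hf : secondaryInvHom hq hθ t (Uq.f q) = _ := Uq.lift_f _
      obtain ⟨r1, r2⟩ := roundtrip_equitable hq hθ t (UqEquitable.x q) (UqEquitable.z q)
        (UqEquitable.y q)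
      apply UqEquitable.hom_ext
      · rw [AlgHom.comp_apply, secondaryHom, UqEquitable.lift_x, map_sub, map_smul, map_mul,
          map_units_zpow _ hk, hk, hf, inv_zpow', show -(1 + t) = -1 - t by ring, r1,
          AlgHom.id_apply]
      · rw [AlgHom.comp_apply, secondaryHom, UqEquitable.lift_y, map_units_inv _ hk, inv_inv,
          AlgHom.id_apply]
      · rw [AlgHom.comp_apply, secondaryHom, UqEquitable.lift_z, map_add, map_smul, map_mul,
          map_units_zpow _ hk, hk, he, inv_zpow', neg_neg, r2, AlgHom.id_apply])

end Identifications

section Modules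

variable {F : Type*} [Field F]

/-- The vector `v_i` of the standard basis of `F^(d+1)`. -/
def stdVec (F : Type*) [Field F] (d : ℕ) (i : Fin (d + 1)) : Fin (d + 1) → F := Pi.single i 1

/-- The action of `k^s` on `V_d`: `v_i ↦ q^(s (d - 2 i)) v_i`. -/
noncomputable def vK (q : F) (d : ℕ) (s : ℤ) : Module.End F (Fin (d + 1) → F) :=
  (Pi.basisFun F (Fin (d + 1))).constr F fun i => q ^ (s * ((d : ℤ) - 2 * (i : ℕ))) • stdVec F d i

/-- The action of `f` on `V_d`: `v_i ↦ [i+1]_q v_{i+1}` for `i < d`, and `v_d ↦ 0`. -/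
noncomputable def vF (q : F) (d : ℕ) : Module.End F (Fin (d + 1) → F) :=
  (Pi.basisFun F (Fin (d + 1))).constr F fun i =>
    if h : (i : ℕ) < d then
      qInt q ((i : ℕ) + 1) • stdVec F d ⟨(i : ℕ) + 1, Nat.succ_lt_succ h⟩
    else 0

/-- The action of `e` on `V_d`: `v_i ↦ [d-i+1]_q v_{i-1}` for `1 ≤ i`, and `v_0 ↦ 0`. -/
noncomputable def vE (q : F) (d : ℕ) : Module.End F (Fin (d + 1) → F) :=
  (Pi.basisFun F (Fin (d + 1))).constr F fun i =>
    if 1 ≤ (i : ℕ) then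
      qInt q ((d : ℤ) - (i : ℕ) + 1) •
        stdVec F d ⟨(i : ℕ) - 1, lt_of_le_of_lt (Nat.sub_le _ _) i.isLt⟩
    else 0

theorem vK_apply (q : F) (d : ℕ) (s : ℤ) (i : Fin (d + 1)) :
    vK q d s (stdVec F d i) = q ^ (s * ((d : ℤ) - 2 * (i : ℕ))) • stdVec F d i := by
  rw [vK, show stdVec F d i = Pi.basisFun F (Fin (d + 1)) i by simp [stdVec],
    Module.Basis.constr_basis]
  simp [stdVec]

theorem vF_apply (q : F) (d : ℕ) (i : Fin (d + 1)) :
    vF q d (stdVec F d i) = if h : (i : ℕ) < d then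
      qInt q ((i : ℕ) + 1) • stdVec F d ⟨(i : ℕ) + 1, Nat.succ_lt_succ h⟩ else 0 := by
  rw [vF, show stdVec F d i = Pi.basisFun F (Fin (d + 1)) i by simp [stdVec],
    Module.Basis.constr_basis]

theorem vE_apply (q : F) (d : ℕ) (i : Fin (d + 1)) :
    vE q d (stdVec F d i) = if 1 ≤ (i : ℕ) then
      qInt q ((d : ℤ) - (i : ℕ) + 1) •
        stdVec F d ⟨(i : ℕ) - 1, lt_of_le_of_lt (Nat.sub_le _ _) i.isLt⟩ else 0 := by
  rw [vE, show stdVec F d i = Pi.basisFun F (Fin (d + 1)) i by simp [stdVec],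
    Module.Basis.constr_basis]

theorem end_ext {d : ℕ} {g h : Module.End F (Fin (d + 1) → F)}
    (H : ∀ i, g (stdVec F d i) = h (stdVec F d i)) : g = h := by
  apply (Pi.basisFun F (Fin (d + 1))).ext
  intro i
  simpa [stdVec] using H i

/-- The action of `k` on `V_d`, as an invertible operator. -/
noncomputable def vKUnit {q : F} (hq : q ≠ 0) (d : ℕ) : (Module.End F (Fin (d + 1) → F))ˣ where
  val := vK q d 1
  inv := vK q d (-1)
  val_inv := end_ext fun i => by
    rw [Module.End.mul_apply, vK_apply, map_smul, vK_apply, smul_smul, ← zpow_add₀ hq]; simp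
  inv_val := end_ext fun i => by
    rw [Module.End.mul_apply, vK_apply, map_smul, vK_apply, smul_smul, ← zpow_add₀ hq]; simp

theorem vd_isChevalley {q : F} (hq : q ≠ 0) (d : ℕ) :
    IsChevalley q (vE q d) (vF q d) (vKUnit hq d) where
  ke := end_ext fun i => by
    simp only [vKUnit, LinearMap.smul_apply, Module.End.mul_apply, vK_apply, vE_apply, map_smul]
    split_ifs with h
    · simp only [map_smul, vK_apply, smul_smul]
      congr 1
      rw [mul_comm, ← mul_assoc, ← zpow_add₀ hq]
      congr 2
      push_cast [Nat.cast_sub h]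
      ring
    · simp
  kf := end_ext fun i => by
    simp only [vKUnit, LinearMap.smul_apply, Module.End.mul_apply, vK_apply, vF_apply, map_smul]
    split_ifs with h
    · simp only [map_smul, vK_apply, smul_smul]
      congr 1
      rw [mul_comm, ← mul_assoc, ← zpow_add₀ hq]
      congr 2
      push_cast
      ring
    · simp
  ef := end_ext fun i => by
    have key : ∀ n m : ℤ, qInt q (n + 1) * qInt q (m - n) - qInt q (m - n + 1) * qInt q n
        = (q - q⁻¹)⁻¹ * (q ^ (m - 2 * n) - q ^ (-(m - 2 * n))) := by
      intro n m
      unfold qInt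
      by_cases h1 : q - q⁻¹ = 0
      · simp [h1]
      · have hA : q ^ n ≠ 0 := zpow_ne_zero _ hq
        have hB : q ^ m ≠ 0 := zpow_ne_zero _ hq
        have e1 : q ^ (m - 2 * n) = q ^ m / (q ^ n) ^ 2 := by
          rw [zpow_sub₀ hq, mul_comm, zpow_mul, zpow_ofNat]
        rw [zpow_neg, zpow_neg, zpow_neg, zpow_neg, zpow_neg, zpow_add_one₀ hq, zpow_add_one₀ hq,
          e1, zpow_sub₀ hq]
        rw [div_mul_div_comm, div_mul_div_comm, ← sub_div, div_eq_iff (mul_ne_zero h1 h1),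
          mul_comm (q - q⁻¹)⁻¹, mul_assoc, inv_mul_cancel_left₀ h1]
        field_simp
        ring
    have h1 : vE q d (vF q d (stdVec F d i)) =
        (qInt q ((i : ℕ) + 1) * qInt q ((d : ℤ) - (i : ℕ))) • stdVec F d i := by
      rw [vF_apply]
      split_ifs with h
      · rw [map_smul, vE_apply, if_pos (by simp), smul_smul]
        congr 2
        push_cast
        congr 1
        ring
      · have : (d : ℤ) - (i : ℕ) = 0 := by omega
        rw [this]; simp [qInt]
    have h2 : vF q d (vE q d (stdVec F d i)) =
        (qInt q ((d : ℤ) - (i : ℕ) + 1) * qInt q (i : ℕ)) • stdVec F d i := by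
      rw [vE_apply]
      split_ifs with h
      · have hi : ((i : ℕ) - 1) + 1 = (i : ℕ) := by omega
        have hv : stdVec F d ⟨((i : ℕ) - 1) + 1, by omega⟩ = stdVec F d i :=
          congrArg (stdVec F d) (Fin.ext hi)
        have hz : (((i : ℕ) - 1 : ℕ) : ℤ) + 1 = (i : ℕ) := by exact_mod_cast hi
        rw [map_smul, vF_apply, dif_pos (show ((i : ℕ) - 1) < d by omega), smul_smul, hv, hz]
      · have : ((i : ℕ) : ℤ) = 0 := by omega
        rw [this]; simp [qInt]
    rw [LinearMap.sub_apply, Module.End.mul_apply, Module.End.mul_apply, h1, h2, ← sub_smul, key,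
      LinearMap.smul_apply, LinearMap.sub_apply]
    change _ = _ • (vK q d 1 _ - vK q d (-1) _)
    rw [vK_apply, vK_apply, ← sub_smul, smul_smul, one_mul, neg_one_mul]

/-- The irreducible type 1 module `V_d` of diameter `d`, as the action of `U_q(sl₂)` on
`F^(d+1)`. -/
noncomputable def vd {q : F} (hq : IsGeneric q) (d : ℕ) :
    Uq q →ₐ[F] Module.End F (Fin (d + 1) → F) :=
  Uq.lift (vd_isChevalley hq.ne_zero d)

end Modules

section Operators

variable {F : Type*} [Field F] {V : Type*} [AddCommGroup V] [Module F V]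

/-- Given a family of operators `A i`, an operator that acts on the `μ i`-eigenspace of `φ` as `A i`
for every `i` (and `0` if there is none). It is unique when these eigenspaces span `V`, and it
exists when moreover the `μ i` are distinct. -/
noncomputable def eigenGlue {ι : Type*} (φ : Module.End F V) (μ : ι → F) (A : ι → Module.End F V) :
    Module.End F V :=
  open Classical in
  if h : ∃ T : Module.End F V, ∀ i, ∀ v ∈ φ.eigenspace (μ i), T v = A i v then h.choose else 0

theorem eigenGlue_apply {ι : Type*} {φ : Module.End F V} {μ : ι → F} (A : ι → Module.End F V)
    (hμ : Function.Injective μ) (hφ : ⨆ i, φ.eigenspace (μ i) = ⊤) (i : ι) {v : V}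
    (hv : v ∈ φ.eigenspace (μ i)) : eigenGlue φ μ A v = A i v := by
  classical
  have hex : ∃ T : Module.End F V, ∀ i, ∀ v ∈ φ.eigenspace (μ i), T v = A i v := by
    have hint : DirectSum.IsInternal fun i => φ.eigenspace (μ i) :=
      DirectSum.isInternal_submodule_of_iSupIndep_of_iSup_eq_top
        (φ.eigenspaces_iSupIndep.comp hμ) hφ
    let E := LinearEquiv.ofBijective (DirectSum.coeLinearMap fun i => φ.eigenspace (μ i)) hint
    refine ⟨(DirectSum.toModule F ι V fun i => (A i).comp (φ.eigenspace (μ i)).subtype).comp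
      E.symm.toLinearMap, fun j w hw => ?_⟩
    have : E.symm w = DirectSum.lof F ι (fun i => φ.eigenspace (μ i)) j ⟨w, hw⟩ := by
      rw [LinearEquiv.symm_apply_eq]
      exact (DirectSum.coeLinearMap_lof (fun i => φ.eigenspace (μ i)) j ⟨w, hw⟩).symm
    simp [this]
  rw [eigenGlue, dif_pos hex]
  exact hex.choose_spec i v hv

theorem eq_eigenGlue {ι : Type*} {φ : Module.End F V} {μ : ι → F} (A : ι → Module.End F V)
    (hμ : Function.Injective μ) (hφ : ⨆ i, φ.eigenspace (μ i) = ⊤) {T : Module.End F V}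
    (hT : ∀ i, ∀ v ∈ φ.eigenspace (μ i), T v = A i v) : T = eigenGlue φ μ A := by
  have : (⊤ : Submodule F V) ≤ LinearMap.eqLocus T (eigenGlue φ μ A) := by
    rw [← hφ]
    refine iSup_le fun i v hv => ?_
    rw [LinearMap.mem_eqLocus, hT i v hv, eigenGlue_apply A hμ hφ i hv]
  exact LinearMap.ext fun v => this trivial

/-- `exp_q(φ) = ∑ q^(i choose 2) / [i]!_q φ^i`, a finite sum for nilpotent `φ`. -/
noncomputable def expq (q : F) (φ : Module.End F V) : Module.End F V :=
  ∑ᶠ i : ℕ, (q ^ (i.choose 2) / qFactorial q i) • φ ^ i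

variable {q : F}

/-- The Lusztig operator `T` on the module `ρ`: on the weight space `V(λ)` it is the sum over
`b - a - c = λ` of `(-1)^b q^(b-ac) e^a f^b e^c / ([a]! [b]! [c]!)`. -/
noncomputable def lusztigT (ρ : Uq q →ₐ[F] Module.End F V) : Module.End F V :=
  eigenGlue (ρ (Uq.k q : Uq q)) (fun l : ℤ => q ^ l) fun l =>
    ∑ᶠ p ∈ {p : ℕ × ℕ × ℕ | (p.2.1 : ℤ) - p.1 - p.2.2 = l},
      ((-1) ^ p.2.1 * q ^ ((p.2.1 : ℤ) - p.1 * p.2.2) /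
          (qFactorial q p.1 * qFactorial q p.2.1 * qFactorial q p.2.2)) •
        (ρ (Uq.e q) ^ p.1 * ρ (Uq.f q) ^ p.2.1 * ρ (Uq.e q) ^ p.2.2)

/-- The Lusztig operator `T^∨` on the module `ρ`: on the weight space `V(λ)` it is the sum over
`a - b + c = λ` of `(-1)^b q^(b-ac) f^a e^b f^c / ([a]! [b]! [c]!)`. -/
noncomputable def lusztigTVee (ρ : Uq q →ₐ[F] Module.End F V) : Module.End F V :=
  eigenGlue (ρ (Uq.k q : Uq q)) (fun l : ℤ => q ^ l) fun l =>
    ∑ᶠ p ∈ {p : ℕ × ℕ × ℕ | (p.1 : ℤ) - p.2.1 + p.2.2 = l},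
      ((-1) ^ p.2.1 * q ^ ((p.2.1 : ℤ) - p.1 * p.2.2) /
          (qFactorial q p.1 * qFactorial q p.2.1 * qFactorial q p.2.2)) •
        (ρ (Uq.f q) ^ p.1 * ρ (Uq.e q) ^ p.2.1 * ρ (Uq.f q) ^ p.2.2)

/-- The operator `Y`: it acts on the `q^(d-2i)`-eigenspace of `y` as `q^(2i(d-i))`,
for `0 ≤ i ≤ d`. -/
noncomputable def opY (d : ℕ) (σ : UqEquitable q →ₐ[F] Module.End F V) : Module.End F V :=
  eigenGlue (σ (UqEquitable.y q : UqEquitable q))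
    (fun i : Fin (d + 1) => q ^ ((d : ℤ) - 2 * (i : ℕ)))
    fun i => (q ^ (2 * ((i : ℕ) : ℤ) * ((d : ℤ) - (i : ℕ)))) • (1 : Module.End F V)

/-- The standard rotator `Ω = exp_q(n_x) Y exp_q(n_z)`. -/
noncomputable def rotator (d : ℕ) (σ : UqEquitable q →ₐ[F] Module.End F V) : Module.End F V :=
  expq q (σ (UqEquitable.nx q)) * opY d σ * expq q (σ (UqEquitable.nz q))

/-- `τ_y = exp_q(n_z) Ω`. -/
noncomputable def tauY (d : ℕ) (σ : UqEquitable q →ₐ[F] Module.End F V) : Module.End F V :=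
  expq q (σ (UqEquitable.nz q)) * rotator d σ

end Operators

end QuantumSl2

/-!
The operators `T`, `T^∨` and `τ_y` are antidiagonal on the standard basis `v_0, …, v_d` of `V_d`, so
the proof computes their coefficients and multiplies them.

* For `i + n = d`, `T v_i = (-1)^n q^(n(i+1)) v_n` (`IsWeightBasis.lusztig_sum_apply`). The triple
  sum reduces, through its weight constraint, to a sum over `a` and `c`. The sum over `a` is an
  alternating sum of products of two `q`-binomial coefficients
  (`sum_neg_one_pow_qBinom_add`), which vanishes unless `c = 0`. Exchanging `e` with `f`, `k` with
  `k⁻¹` and `v_i` with `v_{d-i}` gives `T^∨`.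
* Under the primary identification, rescaling to `w_i = θ^i q^(t i (d-i)) v_i` removes both
  parameters: `n_z w_{i+1} = [d-i]_q w_i` and `n_x w_i = -q^(d-1-2i) [i+1]_q w_{i+1}`. In the matrix
  coefficients of `Ω = exp_q(n_x) Y exp_q(n_z)` the quadratic exponents of `q` coming from the
  summation index cancel, and what remains is a `q`-Vandermonde sum with a single term as its
  value (`sum_neg_one_pow_qBinom_sub`). A second use of that sum, at `q⁻¹`, gives
  `τ_y w_i = (-1)^n q^(C(i,2) + C(n,2)) w_n` (`IsRotatorBasis.tauY_apply`). The secondary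
  identification is the primary one for the exchanged generators and the reversed basis.

The products `τ_y T` and `τ_y T^∨` are therefore diagonal, and if `θ^2 = q^(±1)` the coefficient in
the product under consideration does not depend on `i`.
-/

namespace QuantumSl2

/-! ### Quantum binomial coefficients -/

section QBinomial

variable {F : Type*} [Field F] {q : F}

theorem qInt_zero (q : F) : qInt q 0 = 0 := by simp [qInt]

theorem qInt_ne_zero (hq : IsGeneric q) {n : ℤ} (hn : n ≠ 0) : qInt q n ≠ 0 := by
  refine div_ne_zero (fun h => hn ?_) hq.sub_inv_ne_zero
  have := hq.zpow_injective (sub_eq_zero.1 h)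
  omega

theorem qInt_inv (q : F) (n : ℤ) : qInt q⁻¹ n = qInt q n := by
  rw [qInt, qInt, inv_zpow', inv_zpow', neg_neg, inv_inv, ← neg_sub, ← neg_sub q, neg_div_neg_eq]

theorem qInt_add (hq : q ≠ 0) (a b : ℤ) :
    qInt q (a + b) = q ^ b * qInt q a + q ^ (-a) * qInt q b := by
  simp only [qInt, mul_div_assoc', ← add_div, mul_sub, neg_add, ← zpow_add₀ hq]
  congr 1
  ring_nf

theorem qFactorial_zero (q : F) : qFactorial q 0 = 1 := by simp [qFactorial]

theorem qFactorial_succ (q : F) (n : ℕ) :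
    qFactorial q (n + 1) = qFactorial q n * qInt q ((n : ℤ) + 1) :=
  Finset.prod_range_succ _ _

theorem qFactorial_ne_zero (hq : IsGeneric q) (n : ℕ) : qFactorial q n ≠ 0 :=
  Finset.prod_ne_zero_iff.2 fun _ _ => qInt_ne_zero hq (by omega)

/-- The symmetric `q`-binomial coefficient `[n]_q [n-1]_q ⋯ [n-k+1]_q / [k]!_q`. The upper argument
is an arbitrary integer, so that the Pascal rules hold without side conditions. -/
noncomputable def qBinom (q : F) (n : ℤ) (k : ℕ) : F :=
  (∏ s ∈ Finset.range k, qInt q (n - s)) / qFactorial q k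

theorem qBinom_zero_right (q : F) (n : ℤ) : qBinom q n 0 = 1 := by
  simp [qBinom, qFactorial_zero]

theorem qBinom_inv (q : F) (n : ℤ) (k : ℕ) : qBinom q⁻¹ n k = qBinom q n k := by
  simp [qBinom, qFactorial, qInt_inv]

theorem qBinom_eq_zero (q : F) {n k : ℕ} (h : n < k) : qBinom q n k = 0 := by
  rw [qBinom, Finset.prod_eq_zero (Finset.mem_range.2 h) (by rw [sub_self, qInt_zero]), zero_div]

theorem qFactorial_mul_qBinom (hq : IsGeneric q) (n : ℤ) (k : ℕ) :
    qFactorial q k * qBinom q n k = ∏ s ∈ Finset.range k, qInt q (n - s) :=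
  mul_div_cancel₀ _ (qFactorial_ne_zero hq k)

theorem qBinom_succ_right (hq : IsGeneric q) (n : ℤ) (k : ℕ) :
    qInt q ((k : ℤ) + 1) * qBinom q n (k + 1) = qInt q (n - k) * qBinom q n k := by
  have h1 := qInt_ne_zero hq (show (k : ℤ) + 1 ≠ 0 by omega)
  have h2 := qFactorial_ne_zero hq k
  rw [qBinom, qBinom, Finset.prod_range_succ, qFactorial_succ]
  field_simp

theorem qBinom_succ_succ (hq : IsGeneric q) (n : ℤ) (k : ℕ) :
    qInt q ((k : ℤ) + 1) * qBinom q (n + 1) (k + 1) = qInt q (n + 1) * qBinom q n k := by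
  have h1 := qInt_ne_zero hq (show (k : ℤ) + 1 ≠ 0 by omega)
  have h2 := qFactorial_ne_zero hq k
  have h3 : ∀ s : ℕ, n + 1 - ((s + 1 : ℕ) : ℤ) = n - s := fun s => by push_cast; ring
  rw [qBinom, qBinom, Finset.prod_range_succ', qFactorial_succ]
  simp only [h3, Nat.cast_zero, sub_zero]
  field_simp

theorem qBinom_pascal (hq : IsGeneric q) (n : ℤ) (k : ℕ) :
    qBinom q (n + 1) (k + 1) =
      q ^ ((k : ℤ) + 1) * qBinom q n (k + 1) + q ^ ((k : ℤ) - n) * qBinom q n k := by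
  have h := qInt_add hq.ne_zero (n - k) (k + 1)
  rw [show n - (k : ℤ) + (k + 1) = n + 1 by ring, neg_sub] at h
  refine mul_left_cancel₀ (qInt_ne_zero hq (show (k : ℤ) + 1 ≠ 0 by omega)) ?_
  rw [qBinom_succ_succ hq, mul_add, mul_left_comm, qBinom_succ_right hq, h]
  ring

theorem qBinom_pascal' (hq : IsGeneric q) (n : ℤ) (k : ℕ) :
    qBinom q (n + 1) (k + 1) =
      q ^ (-((k : ℤ) + 1)) * qBinom q n (k + 1) + q ^ (n - (k : ℤ)) * qBinom q n k := by
  have h := qInt_add hq.ne_zero (k + 1) (n - k)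
  rw [show (k : ℤ) + 1 + (n - k) = n + 1 by ring] at h
  refine mul_left_cancel₀ (qInt_ne_zero hq (show (k : ℤ) + 1 ≠ 0 by omega)) ?_
  rw [qBinom_succ_succ hq, mul_add, mul_left_comm, qBinom_succ_right hq, h]
  ring

/-- Symmetry `C(n, a) = C(n, n - a)`: times `[a]! [b]!`, both sides are `[a + b]!`. -/
theorem qBinom_symm (hq : IsGeneric q) (a b : ℕ) :
    qBinom q ((a : ℤ) + b) a = qBinom q ((a : ℤ) + b) b := by
  have key : ∀ a b : ℕ, qFactorial q b * qFactorial q a * qBinom q ((a : ℤ) + b) a =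
      qFactorial q (a + b) := by
    intro a b
    rw [mul_assoc, qFactorial_mul_qBinom hq, ← Finset.prod_range_reflect, qFactorial, qFactorial,
      add_comm a b, Finset.prod_range_add]
    congr 1
    refine Finset.prod_congr rfl fun s hs => congrArg _ ?_
    have := Finset.mem_range.1 hs
    push_cast
    omega
  refine mul_left_cancel₀ (mul_ne_zero (qFactorial_ne_zero hq b) (qFactorial_ne_zero hq a)) ?_
  rw [key, mul_comm (qFactorial q b), add_comm (a : ℤ), key, add_comm]

/-- The Pascal rule, summed against an arbitrary function. -/
theorem sum_qBinom_succ (hq : IsGeneric q) (n : ℕ) (g : ℕ → F) :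
    ∑ a ∈ Finset.range (n + 1 + 1), qBinom q ((n + 1 : ℕ) : ℤ) a * g a =
      ∑ a ∈ Finset.range (n + 1),
        qBinom q n a * (q ^ (a : ℤ) * g a + q ^ ((a : ℤ) - n) * g (a + 1)) := by
  have h : ∑ a ∈ Finset.range (n + 1), qBinom q n a * (q ^ (a : ℤ) * g a) =
      ∑ a ∈ Finset.range (n + 1), qBinom q n (a + 1) * (q ^ ((a : ℤ) + 1) * g (a + 1)) + g 0 := by
    have := Finset.sum_range_succ' (fun a => qBinom q n a * (q ^ (a : ℤ) * g a)) (n + 1)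
    rw [Finset.sum_range_succ, qBinom_eq_zero q (Nat.lt_succ_self n), zero_mul, add_zero] at this
    rw [this]
    simp [qBinom_zero_right]
  simp only [mul_add]
  rw [Finset.sum_add_distrib, h, Finset.sum_range_succ', qBinom_zero_right, one_mul,
    add_right_comm, ← Finset.sum_add_distrib]
  congr 1
  refine Finset.sum_congr rfl fun a _ => ?_
  push_cast
  rw [qBinom_pascal hq]
  ring

/-- The `q`-analogue of `∑ (-1)^a C(i,a) C(n+a,m) = (-1)^i C(n,m-i)`. The induction on `i` uses the
Pascal rule in the first factor and then, on the right-hand side, in the second form. -/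
theorem sum_neg_one_pow_qBinom_add (hq : IsGeneric q) (m i : ℕ) (n : ℤ) :
    ∑ a ∈ Finset.range (i + 1),
        qBinom q i a * ((-1) ^ a * q ^ ((a : ℤ) * (1 - i + m)) * qBinom q (n + a) m) =
      if i ≤ m then (-1) ^ i * q ^ ((i : ℤ) * (n + 1)) * qBinom q n (m - i) else 0 := by
  have h0 := hq.ne_zero
  induction i generalizing n with
  | zero => simp [qBinom_zero_right]
  | succ i ih =>
    have step : ∑ a ∈ Finset.range (i + 1 + 1), qBinom q ((i + 1 : ℕ) : ℤ) a *
          ((-1) ^ a * q ^ ((a : ℤ) * (1 - (i + 1 : ℕ) + m)) * qBinom q (n + a) m) =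
        (∑ a ∈ Finset.range (i + 1),
          qBinom q i a * ((-1) ^ a * q ^ ((a : ℤ) * (1 - i + m)) * qBinom q (n + a) m)) -
        q ^ ((m : ℤ) - 2 * i) * ∑ a ∈ Finset.range (i + 1),
          qBinom q i a * ((-1) ^ a * q ^ ((a : ℤ) * (1 - i + m)) * qBinom q (n + 1 + a) m) := by
      rw [sum_qBinom_succ hq, Finset.mul_sum, ← Finset.sum_sub_distrib]
      refine Finset.sum_congr rfl fun a _ => ?_
      have e1 : q ^ (a : ℤ) * q ^ ((a : ℤ) * (1 - (i + 1 : ℕ) + m)) =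
          q ^ ((a : ℤ) * (1 - i + m)) := by
        rw [← zpow_add₀ h0]; congr 1; push_cast; ring
      have e2 : q ^ ((a : ℤ) - i) * q ^ (((a + 1 : ℕ) : ℤ) * (1 - (i + 1 : ℕ) + m)) =
          q ^ ((m : ℤ) - 2 * i) * q ^ ((a : ℤ) * (1 - i + m)) := by
        rw [← zpow_add₀ h0, ← zpow_add₀ h0]; congr 1; push_cast; ring
      have e3 : n + ((a + 1 : ℕ) : ℤ) = n + 1 + a := by push_cast; ring
      rw [e3, pow_succ]
      linear_combination (qBinom q i a * (-1) ^ a * qBinom q (n + a) m) * e1 -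
        (qBinom q i a * (-1) ^ a * qBinom q (n + 1 + a) m) * e2
    rw [step, ih, ih]
    rcases lt_trichotomy i m with h | rfl | h
    · obtain ⟨k, rfl⟩ : ∃ k, m = i + 1 + k := ⟨m - (i + 1), by omega⟩
      have e1 : i + 1 + k - i = k + 1 := by omega
      have e2 : i + 1 + k - (i + 1) = k := by omega
      rw [if_pos (by omega), if_pos (by omega), if_pos (by omega), e1, e2, qBinom_pascal' hq]
      have z1 : q ^ (((i + 1 + k : ℕ) : ℤ) - 2 * i) * q ^ ((i : ℤ) * (n + 1 + 1)) *
          q ^ (-((k : ℤ) + 1)) = q ^ ((i : ℤ) * (n + 1)) := by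
        rw [← zpow_add₀ h0, ← zpow_add₀ h0]; congr 1; push_cast; ring
      have z2 : q ^ (((i + 1 + k : ℕ) : ℤ) - 2 * i) * q ^ ((i : ℤ) * (n + 1 + 1)) *
          q ^ (n - (k : ℤ)) = q ^ (((i + 1 : ℕ) : ℤ) * (n + 1)) := by
        rw [← zpow_add₀ h0, ← zpow_add₀ h0]; congr 1; push_cast; ring
      rw [pow_succ]
      linear_combination (-(-1) ^ i * qBinom q n (k + 1)) * z1 + (-(-1) ^ i * qBinom q n k) * z2
    · rw [if_pos le_rfl, if_pos le_rfl, if_neg (by omega), Nat.sub_self, qBinom_zero_right,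
        qBinom_zero_right]
      have : q ^ ((i : ℤ) - 2 * i) * q ^ ((i : ℤ) * (n + 1 + 1)) = q ^ ((i : ℤ) * (n + 1)) := by
        rw [← zpow_add₀ h0]; congr 1; ring
      linear_combination (-(-1) ^ i) * this
    · rw [if_neg (by omega), if_neg (by omega), if_neg (by omega)]
      ring

/-- The `q`-analogue of `∑ (-1)^a C(j,a) C(n-a,p) = C(n-j,p-j)`. -/
theorem sum_neg_one_pow_qBinom_sub (hq : IsGeneric q) (p j : ℕ) (n : ℤ) :
    ∑ a ∈ Finset.range (j + 1),
        qBinom q j a * ((-1) ^ a * q ^ ((a : ℤ) * (p + 1 - j)) * qBinom q (n - a) p) =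
      if j ≤ p then q ^ (-(j : ℤ) * (n - p)) * qBinom q (n - j) (p - j) else 0 := by
  have h0 := hq.ne_zero
  induction j generalizing n with
  | zero => simp [qBinom_zero_right]
  | succ j ih =>
    have step : ∑ a ∈ Finset.range (j + 1 + 1), qBinom q ((j + 1 : ℕ) : ℤ) a *
          ((-1) ^ a * q ^ ((a : ℤ) * (p + 1 - (j + 1 : ℕ))) * qBinom q (n - a) p) =
        (∑ a ∈ Finset.range (j + 1),
          qBinom q j a * ((-1) ^ a * q ^ ((a : ℤ) * (p + 1 - j)) * qBinom q (n - a) p)) -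
        q ^ ((p : ℤ) - 2 * j) * ∑ a ∈ Finset.range (j + 1),
          qBinom q j a * ((-1) ^ a * q ^ ((a : ℤ) * (p + 1 - j)) * qBinom q (n - 1 - a) p) := by
      rw [sum_qBinom_succ hq, Finset.mul_sum, ← Finset.sum_sub_distrib]
      refine Finset.sum_congr rfl fun a _ => ?_
      have e1 : q ^ (a : ℤ) * q ^ ((a : ℤ) * (p + 1 - (j + 1 : ℕ))) =
          q ^ ((a : ℤ) * (p + 1 - j)) := by
        rw [← zpow_add₀ h0]; congr 1; push_cast; ring
      have e2 : q ^ ((a : ℤ) - j) * q ^ (((a + 1 : ℕ) : ℤ) * (p + 1 - (j + 1 : ℕ))) =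
          q ^ ((p : ℤ) - 2 * j) * q ^ ((a : ℤ) * (p + 1 - j)) := by
        rw [← zpow_add₀ h0, ← zpow_add₀ h0]; congr 1; push_cast; ring
      have e3 : n - ((a + 1 : ℕ) : ℤ) = n - 1 - a := by push_cast; ring
      rw [e3, pow_succ]
      linear_combination (qBinom q j a * (-1) ^ a * qBinom q (n - a) p) * e1 -
        (qBinom q j a * (-1) ^ a * qBinom q (n - 1 - a) p) * e2
    rw [step, ih, ih]
    rcases lt_trichotomy j p with h | rfl | h
    · obtain ⟨k, rfl⟩ : ∃ k, p = j + 1 + k := ⟨p - (j + 1), by omega⟩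
      have e1 : j + 1 + k - j = k + 1 := by omega
      have e2 : j + 1 + k - (j + 1) = k := by omega
      have e3 : n - j = n - 1 - j + 1 := by ring
      have e4 : n - ((j + 1 : ℕ) : ℤ) = n - 1 - j := by push_cast; ring
      rw [if_pos (by omega), if_pos (by omega), if_pos (by omega), e1, e2, e3, e4,
        qBinom_pascal hq]
      have z1 : q ^ (((j + 1 + k : ℕ) : ℤ) - 2 * j) *
          q ^ (-(j : ℤ) * (n - 1 - (j + 1 + k : ℕ))) =
          q ^ (-(j : ℤ) * (n - (j + 1 + k : ℕ))) * q ^ ((k : ℤ) + 1) := by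
        rw [← zpow_add₀ h0, ← zpow_add₀ h0]; congr 1; push_cast; ring
      have z2 : q ^ (-(j : ℤ) * (n - (j + 1 + k : ℕ))) * q ^ ((k : ℤ) - (n - 1 - j)) =
          q ^ (-((j + 1 : ℕ) : ℤ) * (n - (j + 1 + k : ℕ))) := by
        rw [← zpow_add₀ h0]; congr 1; push_cast; ring
      linear_combination (-qBinom q (n - 1 - j) (k + 1)) * z1 + qBinom q (n - 1 - j) k * z2
    · rw [if_pos le_rfl, if_pos le_rfl, if_neg (by omega), Nat.sub_self, qBinom_zero_right,
        qBinom_zero_right]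
      have : q ^ ((j : ℤ) - 2 * j) * q ^ (-(j : ℤ) * (n - 1 - j)) = q ^ (-(j : ℤ) * (n - j)) := by
        rw [← zpow_add₀ h0]; congr 1; ring
      linear_combination -this
    · rw [if_neg (by omega), if_neg (by omega), if_neg (by omega)]
      ring

/-- The identity `sum_neg_one_pow_qBinom_sub` at `q⁻¹`, for `n = j`. -/
theorem sum_neg_one_pow_qBinom_inv (hq : IsGeneric q) (p j : ℕ) :
    ∑ a ∈ Finset.range (j + 1),
        qBinom q j a * ((-1) ^ a * q ^ (-((a : ℤ) * (p + 1 - j))) * qBinom q ((j : ℤ) - a) p) =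
      if j = p then 1 else 0 := by
  have hq' : IsGeneric q⁻¹ := ⟨inv_ne_zero hq.ne_zero, fun n hn => by
    rw [inv_pow, ne_eq, inv_eq_one]; exact hq.2 n hn⟩
  have := sum_neg_one_pow_qBinom_sub hq' p j j
  simp only [qBinom_inv, inv_zpow', sub_self] at this
  rw [this]
  rcases lt_trichotomy j p with h | rfl | h
  · have := qBinom_eq_zero q (show 0 < p - j by omega)
    rw [if_pos h.le, if_neg h.ne, ← Nat.cast_zero, this, mul_zero]
  · simp [qBinom_zero_right]
  · rw [if_neg (by omega), if_neg (by omega)]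

end QBinomial

/-! ### The Lusztig operators on the standard basis -/

section WeightBasis

variable {F : Type*} [Field F] {q : F} {V : Type*} [AddCommGroup V] [Module F V]

/-- The vectors `v 0, …, v d` span `V`, and `e`, `f`, `K` act on them as the Chevalley generators do
on the standard basis of `V_d`. The family is extended by `v i = 0` for `i > d`, so that
`f v_i = [i+1]_q v_{i+1}` and `e v_{i+1} = [d-i]_q v_i` hold for all `i`. -/
structure IsWeightBasis (q : F) (d : ℕ) (e f : Module.End F V) (K : (Module.End F V)ˣ)
    (v : ℕ → V) : Prop where
  eq_zero : ∀ i, d < i → v i = 0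
  span : Submodule.span F (Set.range v) = ⊤
  k : ∀ i : ℕ, (K : Module.End F V) (v i) = q ^ ((d : ℤ) - 2 * i) • v i
  e_zero : e (v 0) = 0
  e_succ : ∀ i : ℕ, e (v (i + 1)) = qInt q ((d : ℤ) - i) • v i
  f : ∀ i : ℕ, f (v i) = qInt q ((i : ℤ) + 1) • v (i + 1)

/-- Only the vectors `v i` with `i ≤ d` matter; the complementary index `n = d - i` is carried along
because the operators below send `v i` to a multiple of `v n`. -/
theorem ext_of_span {v : ℕ → V} {d : ℕ} (h0 : ∀ i, d < i → v i = 0)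
    (hs : Submodule.span F (Set.range v) = ⊤) {A B : Module.End F V}
    (h : ∀ i n, i + n = d → A (v i) = B (v i)) : A = B := by
  refine LinearMap.ext_on_range hs fun i => ?_
  rcases le_or_gt i d with hi | hi
  · exact h i (d - i) (by omega)
  · rw [h0 i hi, map_zero, map_zero]

theorem zpow_apply_of_eigenvector {K : (Module.End F V)ˣ} {v : V} {c : F} (hc : c ≠ 0)
    (h : (K : Module.End F V) v = c • v) (n : ℤ) :
    ((K ^ n : (Module.End F V)ˣ) : Module.End F V) v = c ^ n • v := by
  have hinv : ((K⁻¹ : (Module.End F V)ˣ) : Module.End F V) v = c⁻¹ • v := by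
    have h1 := congrArg ((K⁻¹ : (Module.End F V)ˣ) : Module.End F V) h
    rw [← Module.End.mul_apply, Units.inv_mul, Module.End.one_apply, map_smul] at h1
    rw [eq_inv_smul_iff₀ hc, ← h1]
  induction n using Int.induction_on with
  | zero => simp
  | succ n ih =>
    rw [zpow_add_one, Units.val_mul, Module.End.mul_apply, h, map_smul, ih, smul_smul,
      zpow_add_one₀ hc, mul_comm]
  | pred n ih =>
    rw [zpow_sub_one, Units.val_mul, Module.End.mul_apply, hinv, map_smul, ih, smul_smul,
      zpow_sub_one₀ hc, mul_comm]

/-- Divided powers of a lowering operator: both `e` on the weight basis and `n_z` on its rescaling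
have this form. -/
theorem lower_pow_apply (hq : IsGeneric q) {d : ℕ} {φ : Module.End F V} {v : ℕ → V}
    (h : ∀ i : ℕ, φ (v (i + 1)) = qInt q ((d : ℤ) - i) • v i) (j a : ℕ) :
    (φ ^ a) (v (j + a)) = (qFactorial q a * qBinom q ((d : ℤ) - j) a) • v j := by
  rw [qFactorial_mul_qBinom hq]
  induction a with
  | zero => simp
  | succ a ih =>
    rw [pow_succ, Module.End.mul_apply, ← add_assoc, h, map_smul, ih, smul_smul,
      Finset.prod_range_succ, mul_comm, Nat.cast_add, sub_sub]

theorem lower_pow_apply_eq_zero {d : ℕ} {φ : Module.End F V} {v : ℕ → V}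
    (h0 : φ (v 0) = 0) (h : ∀ i : ℕ, φ (v (i + 1)) = qInt q ((d : ℤ) - i) • v i) {i a : ℕ}
    (hia : i < a) : (φ ^ a) (v i) = 0 := by
  induction i generalizing a with
  | zero =>
    obtain ⟨a, rfl⟩ := Nat.exists_eq_add_of_lt hia
    rw [pow_succ, Module.End.mul_apply, h0, map_zero]
  | succ i ih =>
    obtain ⟨a, rfl⟩ : ∃ b, a = b + 1 := ⟨a - 1, by omega⟩
    rw [pow_succ, Module.End.mul_apply, h, map_smul, ih (by omega), smul_zero]

theorem lower_pow_eq_zero {d : ℕ} {φ : Module.End F V} {v : ℕ → V}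
    (hv : ∀ i, d < i → v i = 0) (hs : Submodule.span F (Set.range v) = ⊤)
    (h0 : φ (v 0) = 0) (h : ∀ i : ℕ, φ (v (i + 1)) = qInt q ((d : ℤ) - i) • v i) :
    φ ^ (d + 1) = 0 :=
  ext_of_span hv hs fun _ _ _ => lower_pow_apply_eq_zero h0 h (by omega)

namespace IsWeightBasis

variable {d : ℕ} {e f : Module.End F V} {K : (Module.End F V)ˣ} {v : ℕ → V}

theorem k_zpow (hq : q ≠ 0) (h : IsWeightBasis q d e f K v) (n : ℤ) (i : ℕ) :
    ((K ^ n : (Module.End F V)ˣ) : Module.End F V) (v i) = q ^ (n * ((d : ℤ) - 2 * i)) • v i := by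
  rw [zpow_apply_of_eigenvector (zpow_ne_zero _ hq) (h.k i), ← zpow_mul, mul_comm]

/-- Exchanging `e ↔ f`, `K ↔ K⁻¹` and reversing the basis. -/
theorem swap (hq : q ≠ 0) (h : IsWeightBasis q d e f K v) :
    IsWeightBasis q d f e K⁻¹ (fun i => if i ≤ d then v (d - i) else 0) where
  eq_zero i hi := if_neg (by omega)
  span := by
    refine eq_top_iff.2 (h.span ▸ Submodule.span_le.2 ?_)
    rintro _ ⟨i, rfl⟩
    rcases le_or_gt i d with hi | hi
    · refine Submodule.subset_span ⟨d - i, ?_⟩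
      simp only [if_pos (Nat.sub_le d i), Nat.sub_sub_self hi]
    · rw [h.eq_zero i hi]
      exact zero_mem _
  k i := by
    split_ifs with hi
    · rw [← zpow_neg_one, h.k_zpow hq, Nat.cast_sub hi]
      congr 2
      ring
    · simp
  e_zero := by simp [h.f, h.eq_zero (d + 1) (by omega)]
  e_succ i := by
    split_ifs with h1 h2 h2
    · rw [h.f, show d - (i + 1) + 1 = d - i by omega, Nat.cast_sub h1]
      congr 2
      push_cast
      ring
    · omega
    · rw [show (d : ℤ) - i = 0 by omega, qInt_zero, zero_smul, map_zero]
    · simp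
  f i := by
    split_ifs with h1 h2 h2
    · rw [show d - i = d - (i + 1) + 1 by omega, h.e_succ, Nat.cast_sub h2]
      congr 2
      push_cast
      ring
    · rw [show d - i = 0 by omega, h.e_zero, smul_zero]
    · omega
    · simp

theorem f_pow_apply (hq : IsGeneric q) (h : IsWeightBasis q d e f K v) (j b : ℕ) :
    (f ^ b) (v j) = (qFactorial q b * qBinom q ((j : ℤ) + b) b) • v (j + b) := by
  induction b with
  | zero => simp [qFactorial_zero, qBinom_zero_right]
  | succ b ih =>
    have := qBinom_succ_succ hq ((j : ℤ) + b) b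
    rw [pow_succ', Module.End.mul_apply, ih, map_smul, h.f, smul_smul, qFactorial_succ, mul_assoc,
      Nat.cast_succ, mul_assoc (qFactorial q b) (qInt q _), ← add_assoc, ← add_assoc, this]
    congr 1
    push_cast
    ring

theorem iSup_eigenspace_int (h : IsWeightBasis q d e f K v) :
    ⨆ l : ℤ, (K : Module.End F V).eigenspace (q ^ l) = ⊤ := by
  refine eq_top_iff.2 (h.span ▸ Submodule.span_le.2 ?_)
  rintro _ ⟨i, rfl⟩
  exact (le_iSup (fun l : ℤ => (K : Module.End F V).eigenspace (q ^ l)) _)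
    (Module.End.mem_eigenspace_iff.2 (h.k i))

/-- The summand of the Lusztig operator at `(a, b, c)`, on a vector of the weight basis. -/
theorem lusztig_summand_apply (hq : IsGeneric q) (h : IsWeightBasis q d e f K v) {i n : ℕ}
    (hd : i + n = d) {a b c : ℕ} (hc : c ≤ i) (hb : b + i = a + c + n) :
    (((-1) ^ b * q ^ ((b : ℤ) - a * c) / (qFactorial q a * qFactorial q b * qFactorial q c)) •
      (e ^ a * f ^ b * e ^ c)) (v i) =
    ((-1) ^ (c + d) * q ^ ((c : ℤ) + n - i) * qBinom q ((n : ℤ) + c) c *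
      (qBinom q i a * ((-1) ^ a * q ^ ((a : ℤ) * (1 - i + (i - c : ℕ))) *
        qBinom q ((n : ℤ) + a) (i - c)))) • v n := by
  obtain ⟨s, rfl⟩ : ∃ s, i = s + c := ⟨i - c, by omega⟩
  have ha := qFactorial_ne_zero hq a
  have hb' := qFactorial_ne_zero hq b
  have hc' := qFactorial_ne_zero hq c
  have hsb : s + b = n + a := by omega
  have e1 : (d : ℤ) - s = n + c := by omega
  have e2 : (d : ℤ) - n = (s + c : ℕ) := by omega
  have e3 : qBinom q ((s : ℤ) + b) b = qBinom q ((n : ℤ) + a) s := by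
    rw [← qBinom_symm hq]; congr 1; omega
  have e4 : q ^ ((b : ℤ) - a * c) = q ^ ((c : ℤ) + n - (s + c : ℕ)) *
      q ^ ((a : ℤ) * (1 - (s + c : ℕ) + s)) := by
    rw [← zpow_add₀ hq.ne_zero, show (b : ℤ) = n + a - s by omega]
    congr 1; push_cast; ring
  have e5 : (-1 : F) ^ b = (-1) ^ (c + d) * (-1) ^ a := by
    rw [← pow_add, show c + d + a = b + 2 * (s + c) by omega, pow_add, pow_mul]; simp
  rw [LinearMap.smul_apply, Module.End.mul_apply, Module.End.mul_apply,
    lower_pow_apply hq h.e_succ, map_smul, h.f_pow_apply hq, map_smul, map_smul, hsb,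
    lower_pow_apply hq h.e_succ, smul_smul, smul_smul, smul_smul, e1, e2, e3, e4, e5,
    Nat.add_sub_cancel]
  congr 1
  field_simp

/-- The sum that defines the Lusztig operator `T` on the weight space of `v i`, evaluated on `v i`.
The inner sum over `a` vanishes unless `c = 0`. -/
theorem lusztig_sum_apply (hq : IsGeneric q) (h : IsWeightBasis q d e f K v) {i n : ℕ}
    (hd : i + n = d) {S : Set (ℕ × ℕ × ℕ)}
    (hS : ∀ p, p ∈ S ↔ (p.2.1 : ℤ) - p.1 - p.2.2 = (n : ℤ) - i) :
    (∑ᶠ p ∈ S, ((-1) ^ p.2.1 * q ^ ((p.2.1 : ℤ) - p.1 * p.2.2) /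
        (qFactorial q p.1 * qFactorial q p.2.1 * qFactorial q p.2.2)) •
      (e ^ p.1 * f ^ p.2.1 * e ^ p.2.2)) (v i) =
    ((-1) ^ n * q ^ ((n : ℤ) * (i + 1))) • v n := by
  have hnil : ∀ a, d < a → e ^ a = 0 := fun a ha =>
    pow_eq_zero_of_le ha (lower_pow_eq_zero h.eq_zero h.span h.e_zero h.e_succ)
  -- `a`, `c` run up to `d` as `e ^ (d + 1) = 0`, and the weight constraint determines `b`.
  let t : Finset (ℕ × ℕ × ℕ) :=
    ((Finset.range (d + 1) ×ˢ Finset.range (d + 1)).filter fun x => i ≤ x.2 + x.1 + n).image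
      fun x => (x.2, x.2 + x.1 + n - i, x.1)
  rw [finsum_mem_eq_sum_of_subset (t := t)]
  rotate_left
  · rintro ⟨a, b, c⟩ ⟨h1, h2⟩
    replace h1 := (hS _).1 h1
    have ha : a ≤ d := by
      by_contra hcon
      exact h2 (by simp [hnil a (by omega)])
    have hc : c ≤ d := by
      by_contra hcon
      exact h2 (by simp [hnil c (by omega)])
    simp only at h1
    simp only [t, Finset.coe_image, Set.mem_image, Finset.mem_coe, Finset.mem_filter,
      Finset.mem_product, Finset.mem_range, Prod.mk.injEq, Prod.exists]
    exact ⟨c, a, by omega, rfl, by omega, rfl⟩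
  · intro p hp
    simp only [t, Finset.coe_image, Set.mem_image, Finset.mem_coe, Finset.mem_filter] at hp
    obtain ⟨x, ⟨-, hx⟩, rfl⟩ := hp
    rw [hS]
    simp only
    omega
  rw [Finset.sum_image (by
    rintro ⟨c, a⟩ _ ⟨c', a'⟩ _ hx
    simp only [Prod.mk.injEq] at hx
    simp [hx.1, hx.2.2]), LinearMap.sum_apply, Finset.sum_filter, Finset.sum_product]
  have inner : ∀ c ∈ Finset.range (d + 1), (∑ a ∈ Finset.range (d + 1),
      if i ≤ a + c + n then
        (((-1) ^ (a + c + n - i) * q ^ (((a + c + n - i : ℕ) : ℤ) - a * c) /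
            (qFactorial q a * qFactorial q (a + c + n - i) * qFactorial q c)) •
          (e ^ a * f ^ (a + c + n - i) * e ^ c)) (v i)
      else 0) = if c = 0 then ((-1) ^ n * q ^ ((n : ℤ) * (i + 1))) • v n else 0 := by
    intro c _
    rcases le_or_gt c i with hc | hc
    · have hterm : ∀ a ∈ Finset.range (d + 1), (if i ≤ a + c + n then
          (((-1) ^ (a + c + n - i) * q ^ (((a + c + n - i : ℕ) : ℤ) - a * c) /
              (qFactorial q a * qFactorial q (a + c + n - i) * qFactorial q c)) •
            (e ^ a * f ^ (a + c + n - i) * e ^ c)) (v i)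
          else 0) = ((-1) ^ (c + d) * q ^ ((c : ℤ) + n - i) * qBinom q ((n : ℤ) + c) c *
            (qBinom q i a * ((-1) ^ a * q ^ ((a : ℤ) * (1 - i + (i - c : ℕ))) *
              qBinom q ((n : ℤ) + a) (i - c)))) • v n := by
        intro a _
        split_ifs with hi
        · exact h.lusztig_summand_apply hq hd hc (by omega)
        -- No `b ≥ 0` has the right weight; the closed form is then zero as well.
        · have := qBinom_eq_zero q (show n + a < i - c by omega)
          push_cast at this
          simp [this]
      rw [Finset.sum_congr rfl hterm, ← Finset.sum_smul, ← Finset.mul_sum,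
        ← Finset.sum_subset (Finset.range_mono (show i + 1 ≤ d + 1 by omega)) (fun a _ ha => by
          rw [qBinom_eq_zero q (by simpa using ha), zero_mul]),
        sum_neg_one_pow_qBinom_add hq]
      by_cases hc0 : c = 0
      · subst hc0
        rw [if_pos (by omega), if_pos rfl, Nat.sub_zero, Nat.sub_self, qBinom_zero_right,
          qBinom_zero_right]
        have e1 : (-1 : F) ^ (0 + d) * (-1) ^ i = (-1) ^ n := by
          rw [← pow_add, show 0 + d + i = n + 2 * i by omega, pow_add, pow_mul]; simp
        have e2 : q ^ (((0 : ℕ) : ℤ) + n - i) * q ^ ((i : ℤ) * (n + 1)) =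
            q ^ ((n : ℤ) * (i + 1)) := by
          rw [← zpow_add₀ hq.ne_zero]; congr 1; push_cast; ring
        rw [← e1, ← e2]
        congr 1
        ring
      · rw [if_neg (by omega), if_neg hc0, mul_zero, zero_smul]
    -- For `c > i` already `e ^ c` kills `v i`.
    · rw [if_neg (by omega)]
      refine Finset.sum_eq_zero fun a _ => ?_
      rw [LinearMap.smul_apply, Module.End.mul_apply,
        lower_pow_apply_eq_zero h.e_zero h.e_succ hc, map_zero, smul_zero, ite_self]
  rw [Finset.sum_congr rfl inner, Finset.sum_ite_eq' _ 0, if_pos (by simp)]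

end IsWeightBasis

theorem lusztigT_apply (hq : IsGeneric q) {ρ : Uq q →ₐ[F] Module.End F V} {d : ℕ} {v : ℕ → V}
    (h : IsWeightBasis q d (ρ (Uq.e q)) (ρ (Uq.f q))
      (Units.map (ρ : Uq q →* Module.End F V) (Uq.k q)) v) {i n : ℕ} (hd : i + n = d) :
    lusztigT ρ (v i) = ((-1) ^ n * q ^ ((n : ℤ) * (i + 1))) • v n := by
  refine (eigenGlue_apply (φ := ρ (Uq.k q : Uq q)) _ hq.zpow_injective h.iSup_eigenspace_int _
    (Module.End.mem_eigenspace_iff.2 (h.k i))).trans ?_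
  exact h.lusztig_sum_apply hq hd fun p => by
    rw [Set.mem_ofPred_eq, ← hd]; push_cast; omega

theorem lusztigTVee_apply (hq : IsGeneric q) {ρ : Uq q →ₐ[F] Module.End F V} {d : ℕ} {v : ℕ → V}
    (h : IsWeightBasis q d (ρ (Uq.e q)) (ρ (Uq.f q))
      (Units.map (ρ : Uq q →* Module.End F V) (Uq.k q)) v) {i n : ℕ} (hd : i + n = d) :
    lusztigTVee ρ (v i) = ((-1) ^ i * q ^ ((i : ℤ) * (n + 1))) • v n := by
  refine (eigenGlue_apply (φ := ρ (Uq.k q : Uq q)) _ hq.zpow_injective h.iSup_eigenspace_int _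
    (Module.End.mem_eigenspace_iff.2 (h.k i))).trans ?_
  have := (h.swap hq.ne_zero).lusztig_sum_apply hq (show n + i = d by omega)
    (S := {p : ℕ × ℕ × ℕ | (p.1 : ℤ) - p.2.1 + p.2.2 = (d : ℤ) - 2 * i}) fun p => by
      rw [Set.mem_ofPred_eq, ← hd]; push_cast; omega
  rw [if_pos (by omega), if_pos (by omega), show d - n = i by omega,
    show d - i = n by omega] at this
  exact this

end WeightBasis

/-! ### The rotator and `τ_y` on a normalized basis -/

section Rotator

variable {F : Type*} [Field F] {q : F} {V : Type*} [AddCommGroup V] [Module F V]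

/-- The binomial coefficient `n (n - 1) / 2` for an arbitrary integer `n`. -/
def intTri (n : ℤ) : ℤ := n * (n - 1) / 2

theorem two_mul_intTri (n : ℤ) : 2 * intTri n = n * (n - 1) := by
  refine Int.mul_ediv_cancel' ?_
  rcases Int.even_or_odd n with h | h
  · exact (h.two_dvd).mul_right _
  · exact Dvd.dvd.mul_left (by obtain ⟨k, rfl⟩ := h; exact ⟨k, by ring⟩) _

theorem natCast_choose_two (n : ℕ) : ((n.choose 2 : ℕ) : ℤ) = intTri n := by
  have h := Nat.choose_two_right n
  have h2 := two_mul_intTri n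
  have h3 : 2 * n.choose 2 = n * (n - 1) := by
    rw [h]; exact Nat.mul_div_cancel' (Nat.even_mul_pred_self n).two_dvd
  rcases n with _ | n
  · simp [intTri]
  · have h4 : (2 : ℤ) * ((n + 1).choose 2 : ℕ) = ((n + 1 : ℕ) : ℤ) * (n : ℤ) := by
      exact_mod_cast h3
    push_cast at h2 h4 ⊢
    linarith

theorem expq_apply_of_pow_eq_zero {φ : Module.End F V} {N : ℕ} (h : φ ^ N = 0) (v : V) :
    expq q φ v = ∑ a ∈ Finset.range N, (q ^ intTri a / qFactorial q a) • (φ ^ a) v := by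
  rw [expq, finsum_eq_sum_of_support_subset (s := Finset.range N), LinearMap.sum_apply]
  · refine Finset.sum_congr rfl fun a _ => ?_
    rw [LinearMap.smul_apply, ← natCast_choose_two, zpow_natCast]
  · intro a ha
    by_contra hcon
    have haN : N ≤ a := by simpa using hcon
    exact ha (by simp only [pow_eq_zero_of_le haN h, smul_zero])

/-- The vectors `w 0, …, w d` span the module `σ` of the equitable algebra, they are weight vectors
for `y`, and `n_z`, `n_x` shift them down and up with normalized coefficients. The family is
extended by `w i = 0` for `i > d`. -/
structure IsRotatorBasis (d : ℕ) (σ : UqEquitable q →ₐ[F] Module.End F V) (w : ℕ → V) : Prop where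
  eq_zero : ∀ i, d < i → w i = 0
  span : Submodule.span F (Set.range w) = ⊤
  y : ∀ i : ℕ, σ (UqEquitable.y q : UqEquitable q) (w i) = q ^ ((d : ℤ) - 2 * i) • w i
  nz_zero : σ (UqEquitable.nz q) (w 0) = 0
  nz_succ : ∀ i : ℕ, σ (UqEquitable.nz q) (w (i + 1)) = qInt q ((d : ℤ) - i) • w i
  nx : ∀ i : ℕ, σ (UqEquitable.nx q) (w i) =
    (-(q ^ ((d : ℤ) - 1 - 2 * i) * qInt q ((i : ℤ) + 1))) • w (i + 1)

namespace IsRotatorBasis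

variable {d : ℕ} {σ : UqEquitable q →ₐ[F] Module.End F V} {w : ℕ → V}

theorem opY_apply (hq : IsGeneric q) (h : IsRotatorBasis d σ w) {i : ℕ} (hi : i ≤ d) :
    opY d σ (w i) = q ^ (2 * (i : ℤ) * ((d : ℤ) - i)) • w i := by
  have hinj : Function.Injective fun i : Fin (d + 1) => q ^ ((d : ℤ) - 2 * (i : ℕ)) := by
    intro a b hab
    have := hq.zpow_injective hab
    exact Fin.ext (by omega)
  have hsup : ⨆ i : Fin (d + 1), (σ (UqEquitable.y q : UqEquitable q)).eigenspace
      (q ^ ((d : ℤ) - 2 * (i : ℕ))) = ⊤ := by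
    refine eq_top_iff.2 (h.span ▸ Submodule.span_le.2 ?_)
    rintro _ ⟨j, rfl⟩
    rcases le_or_gt j d with hj | hj
    · exact (le_iSup (fun i : Fin (d + 1) => (σ (UqEquitable.y q : UqEquitable q)).eigenspace
        (q ^ ((d : ℤ) - 2 * (i : ℕ)))) ⟨j, by omega⟩) (Module.End.mem_eigenspace_iff.2 (h.y j))
    · rw [h.eq_zero j hj]
      exact zero_mem _
  rw [opY, eigenGlue_apply _ hinj hsup ⟨i, by omega⟩ (Module.End.mem_eigenspace_iff.2 (h.y i))]
  rfl

theorem expq_nz_apply (hq : IsGeneric q) (h : IsRotatorBasis d σ w) {i n : ℕ} (hd : i + n = d) :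
    expq q (σ (UqEquitable.nz q)) (w i) = ∑ m ∈ Finset.range (d + 1),
      (q ^ intTri ((i : ℤ) - m) * qBinom q ((d - m : ℕ) : ℤ) n) • w m := by
  rw [expq_apply_of_pow_eq_zero (lower_pow_eq_zero h.eq_zero h.span h.nz_zero h.nz_succ),
    ← Finset.sum_subset (Finset.range_mono (show i + 1 ≤ d + 1 by omega)) (fun a _ ha => by
      rw [lower_pow_apply_eq_zero h.nz_zero h.nz_succ (by simpa using ha), smul_zero]),
    ← Finset.sum_subset (Finset.range_mono (show i + 1 ≤ d + 1 by omega)) (fun m h1 h2 => by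
      rw [qBinom_eq_zero q (by simp at h1 h2; omega), mul_zero, zero_smul]),
    ← Finset.sum_range_reflect]
  refine Finset.sum_congr rfl fun m hm => ?_
  obtain ⟨a, rfl⟩ : ∃ a, i = m + a := ⟨i - m, by have := Finset.mem_range.1 hm; omega⟩
  have h1 := qFactorial_ne_zero hq a
  have h2 := qBinom_symm hq n a
  rw [show m + a + 1 - 1 - m = a by omega, lower_pow_apply hq h.nz_succ, smul_smul,
    show ((d - m : ℕ) : ℤ) = (n : ℤ) + a by omega, show (d : ℤ) - m = (n : ℤ) + a by omega, h2,
    show ((m + a : ℕ) : ℤ) - m = a by omega]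
  congr 1
  field_simp

theorem nx_pow_apply (hq : IsGeneric q) (h : IsRotatorBasis d σ w) (m b : ℕ) :
    (σ (UqEquitable.nx q) ^ b) (w m) = ((-1) ^ b * q ^ ((b : ℤ) * (d - 1 - 2 * m) - 2 * intTri b) *
      qFactorial q b * qBinom q ((m : ℤ) + b) b) • w (m + b) := by
  induction b with
  | zero => simp [qFactorial_zero, qBinom_zero_right, intTri]
  | succ b ih =>
    have h1 := qBinom_succ_succ hq ((m : ℤ) + b) b
    have h2 : q ^ (((b + 1 : ℕ) : ℤ) * (d - 1 - 2 * m) - 2 * intTri ((b + 1 : ℕ) : ℤ)) =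
        q ^ ((b : ℤ) * (d - 1 - 2 * m) - 2 * intTri b) * q ^ ((d : ℤ) - 1 - 2 * (m + b : ℕ)) := by
      rw [← zpow_add₀ hq.ne_zero, two_mul_intTri, two_mul_intTri]
      congr 1; push_cast; ring
    rw [pow_succ', Module.End.mul_apply, ih, map_smul, h.nx, smul_smul, qFactorial_succ, h2,
      pow_succ, Nat.cast_succ, ← add_assoc (m : ℤ), Nat.cast_add, ← add_assoc m]
    congr 1
    linear_combination ((-1) ^ b * q ^ ((b : ℤ) * (d - 1 - 2 * m) - 2 * intTri b) *
      q ^ ((d : ℤ) - 1 - 2 * (m + b)) * qFactorial q b) * h1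

theorem expq_nx_apply (hq : IsGeneric q) (h : IsRotatorBasis d σ w) (m : ℕ) :
    expq q (σ (UqEquitable.nx q)) (w m) = ∑ j ∈ Finset.range (d + 1),
      ((-1) ^ (j + m) * q ^ (((j : ℤ) - m) * (d - 1 - 2 * m) - intTri ((j : ℤ) - m)) *
        qBinom q j m) • w j := by
  have hnil : σ (UqEquitable.nx q) ^ (d + 1) = 0 :=
    ext_of_span h.eq_zero h.span fun i _ _ => by
      rw [h.nx_pow_apply hq, h.eq_zero (i + (d + 1)) (by omega), smul_zero, LinearMap.zero_apply]
  have hext : ∀ j ∈ Finset.range (m + (d + 1)), j ∉ Finset.range (d + 1) →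
      ((-1) ^ (j + m) * q ^ (((j : ℤ) - m) * (d - 1 - 2 * m) - intTri ((j : ℤ) - m)) *
        qBinom q j m) • w j = 0 := fun j _ hj => by
    rw [h.eq_zero j (by simpa using hj), smul_zero]
  rw [expq_apply_of_pow_eq_zero hnil,
    Finset.sum_subset (Finset.range_mono (show d + 1 ≤ m + (d + 1) by omega)) hext,
    Finset.sum_range_add _ m, Finset.sum_eq_zero (s := Finset.range m) (fun j hj => by
      rw [qBinom_eq_zero q (Finset.mem_range.1 hj), mul_zero, zero_smul]), zero_add]
  refine Finset.sum_congr rfl fun b _ => ?_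
  have h1 := qFactorial_ne_zero hq b
  have h2 := qBinom_symm hq m b
  have h3 : q ^ (((m + b : ℕ) - m : ℤ) * (d - 1 - 2 * m) - intTri ((m + b : ℕ) - m : ℤ)) =
      q ^ intTri b * q ^ ((b : ℤ) * (d - 1 - 2 * m) - 2 * intTri b) := by
    rw [← zpow_add₀ hq.ne_zero, show ((m + b : ℕ) - m : ℤ) = b by push_cast; ring]
    congr 1; ring
  have h4 : (-1 : F) ^ (m + b + m) = (-1) ^ b := by
    rw [show m + b + m = b + 2 * m by ring, pow_add, pow_mul]; simp
  rw [h.nx_pow_apply hq, smul_smul, h3, h4, Nat.cast_add, h2]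
  congr 1
  field_simp

/-- The matrix of the standard rotator. In each coefficient the terms of the exponent of `q` that
are quadratic in the summation index `m` cancel, so that `sum_neg_one_pow_qBinom_sub` applies. -/
theorem rotator_apply (hq : IsGeneric q) (h : IsRotatorBasis d σ w) {i n : ℕ} (hd : i + n = d) :
    rotator d σ (w i) = ∑ j ∈ Finset.range (d + 1),
      ((-1) ^ j * q ^ (intTri i - intTri j + j * (d - 1 - i)) *
        qBinom q ((d - j : ℕ) : ℤ) i) • w j := by
  have h0 := hq.ne_zero
  rw [rotator, Module.End.mul_apply, Module.End.mul_apply, h.expq_nz_apply hq hd, map_sum, map_sum]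
  -- The exponent of `q` below is linear in `m`.
  have hm : ∀ m ∈ Finset.range (d + 1), expq q (σ (UqEquitable.nx q)) (opY d σ
      ((q ^ intTri ((i : ℤ) - m) * qBinom q ((d - m : ℕ) : ℤ) n) • w m)) =
      ∑ j ∈ Finset.range (d + 1), ((-1) ^ j * q ^ (intTri i - intTri j + j * (d - 1)) *
        (qBinom q j m * ((-1) ^ m * q ^ ((m : ℤ) * (n + 1 - j)) *
          qBinom q ((d : ℤ) - m) n))) • w j := by
    intro m hm
    have hmd : m ≤ d := by simpa [Nat.lt_succ_iff] using hm
    rw [map_smul, h.opY_apply hq hmd, map_smul, map_smul, h.expq_nx_apply hq, Finset.smul_sum,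
      Finset.smul_sum]
    refine Finset.sum_congr rfl fun j _ => ?_
    have e : q ^ intTri ((i : ℤ) - m) * q ^ (2 * (m : ℤ) * ((d : ℤ) - m)) *
        q ^ (((j : ℤ) - m) * (d - 1 - 2 * m) - intTri ((j : ℤ) - m)) =
        q ^ (intTri i - intTri j + j * (d - 1)) * q ^ ((m : ℤ) * (n + 1 - j)) := by
      rw [← zpow_add₀ h0, ← zpow_add₀ h0, ← zpow_add₀ h0]
      congr 1
      have t1 := two_mul_intTri ((i : ℤ) - m)
      have t2 := two_mul_intTri ((j : ℤ) - m)
      have t3 := two_mul_intTri (i : ℤ)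
      have t4 := two_mul_intTri (j : ℤ)
      have hd' : (d : ℤ) = i + n := by omega
      refine mul_left_cancel₀ (two_ne_zero (α := ℤ)) ?_
      rw [hd']
      linear_combination t1 - t2 - t3 + t4
    rw [smul_smul, smul_smul, Nat.cast_sub hmd, pow_add]
    congr 1
    linear_combination ((-1) ^ j * (-1) ^ m * qBinom q ((d : ℤ) - m) n * qBinom q j m) * e
  rw [Finset.sum_congr rfl hm, Finset.sum_comm]
  refine Finset.sum_congr rfl fun j hj => ?_
  have hjd : j ≤ d := by simpa [Nat.lt_succ_iff] using hj
  rw [← Finset.sum_smul, ← Finset.mul_sum,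
    ← Finset.sum_subset (Finset.range_mono (show j + 1 ≤ d + 1 by omega)) (fun m _ hm => by
      rw [qBinom_eq_zero q (by simpa using hm), zero_mul]),
    sum_neg_one_pow_qBinom_sub hq]
  congr 1
  split_ifs with hjn
  · obtain ⟨s, rfl⟩ : ∃ s, n = j + s := ⟨n - j, by omega⟩
    have h2 := qBinom_symm hq i s
    have e : q ^ (intTri i - intTri j + j * ((d : ℤ) - 1 - i)) =
        q ^ (intTri i - intTri j + j * ((d : ℤ) - 1)) * q ^ (-(j : ℤ) * (d - (j + s : ℕ))) := by
      rw [← zpow_add₀ h0, ← hd]; congr 1; push_cast; ring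
    rw [e, Nat.add_sub_cancel_left, Nat.cast_sub hjd,
      show (d : ℤ) - j = i + s by omega, h2]
    ring
  · rw [qBinom_eq_zero q (by omega)]
    ring

/-- Multiplying the rotator by `exp_q(n_z)` from the left removes all terms but one. -/
theorem tauY_apply (hq : IsGeneric q) (h : IsRotatorBasis d σ w) {i n : ℕ} (hd : i + n = d) :
    tauY d σ (w i) = ((-1) ^ n * q ^ (intTri i + intTri n)) • w n := by
  have h0 := hq.ne_zero
  rw [tauY, Module.End.mul_apply, h.rotator_apply hq hd, map_sum]
  have hj : ∀ j ∈ Finset.range (d + 1), expq q (σ (UqEquitable.nz q))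
      (((-1) ^ j * q ^ (intTri i - intTri j + j * (d - 1 - i)) *
        qBinom q ((d - j : ℕ) : ℤ) i) • w j) =
      ∑ l ∈ Finset.range (d + 1), ((-1) ^ j * q ^ (intTri i - intTri j + j * (d - 1 - i)) *
        qBinom q ((d - j : ℕ) : ℤ) i *
          (q ^ intTri ((j : ℤ) - l) * qBinom q ((d - l : ℕ) : ℤ) (d - j))) • w l := by
    intro j hj
    rw [map_smul, h.expq_nz_apply hq (Nat.add_sub_of_le (by simpa [Nat.lt_succ_iff] using hj)),
      Finset.smul_sum]
    simp only [smul_smul]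
  rw [Finset.sum_congr rfl hj, Finset.sum_comm]
  have hl : ∀ l ∈ Finset.range (d + 1), (∑ j ∈ Finset.range (d + 1),
      ((-1) ^ j * q ^ (intTri i - intTri j + j * (d - 1 - i)) *
        qBinom q ((d - j : ℕ) : ℤ) i *
          (q ^ intTri ((j : ℤ) - l) * qBinom q ((d - l : ℕ) : ℤ) (d - j))) • w l) =
      if l = n then ((-1) ^ n * q ^ (intTri i + intTri n)) • w n else 0 := by
    intro l hl
    obtain ⟨s, rfl⟩ : ∃ s, d = l + s := ⟨d - l, by have := Finset.mem_range.1 hl; omega⟩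
    -- The terms with `j < l` vanish; the others are indexed by `a = j - l ≤ s = d - l`.
    rw [← Finset.sum_smul, add_assoc, Finset.sum_range_add, Finset.sum_eq_zero
      (s := Finset.range l) (fun j hj => by
        have := Finset.mem_range.1 hj
        rw [qBinom_eq_zero q (show l + s - l < l + s - j by omega)]; ring), zero_add]
    have hterm : ∀ a ∈ Finset.range (s + 1), (-1) ^ (l + a) *
        q ^ (intTri i - intTri ((l + a : ℕ) : ℤ) + ((l + a : ℕ) : ℤ) * ((l + s : ℕ) - 1 - i)) *
        qBinom q ((l + s - (l + a) : ℕ) : ℤ) i *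
          (q ^ intTri (((l + a : ℕ) : ℤ) - l) *
            qBinom q ((l + s - l : ℕ) : ℤ) (l + s - (l + a))) =
        (-1) ^ l * q ^ (intTri i - intTri l + l * ((l + s : ℕ) - 1 - i)) *
          (qBinom q s a * ((-1) ^ a * q ^ (-((a : ℤ) * (i + 1 - s))) *
            qBinom q ((s : ℤ) - a) i)) := by
      intro a ha
      have has : a ≤ s := by simpa [Nat.lt_succ_iff] using ha
      have h2 := qBinom_symm hq a (s - a)
      rw [show (a : ℤ) + (s - a : ℕ) = s by omega] at h2
      have e : q ^ (intTri i - intTri ((l + a : ℕ) : ℤ) +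
          ((l + a : ℕ) : ℤ) * ((l + s : ℕ) - 1 - i)) * q ^ intTri (a : ℤ) =
          q ^ (intTri i - intTri l + l * ((l + s : ℕ) - 1 - i)) *
            q ^ (-((a : ℤ) * (i + 1 - s))) := by
        rw [← zpow_add₀ h0, ← zpow_add₀ h0]
        congr 1
        have t1 := two_mul_intTri ((l + a : ℕ) : ℤ)
        have t2 := two_mul_intTri (l : ℤ)
        have t3 := two_mul_intTri (a : ℤ)
        refine mul_left_cancel₀ (two_ne_zero (α := ℤ)) ?_
        push_cast at t1 ⊢
        linear_combination -t1 + t2 + t3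
      rw [show ((l + a : ℕ) : ℤ) - l = a by omega, show l + s - (l + a) = s - a by omega,
        show l + s - l = s by omega, ← h2, Nat.cast_sub has, pow_add]
      linear_combination ((-1) ^ l * (-1) ^ a * qBinom q ((s : ℤ) - a) i * qBinom q s a) * e
    rw [Finset.sum_congr rfl hterm, ← Finset.mul_sum, sum_neg_one_pow_qBinom_inv hq]
    by_cases hsi : s = i
    · obtain rfl : l = n := by omega
      have t := two_mul_intTri (l : ℤ)
      rw [if_pos hsi, if_pos rfl, mul_one, hsi,
        show intTri i - intTri l + (l : ℤ) * ((l + i : ℕ) - 1 - i) = intTri i + intTri l by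
          push_cast; linear_combination -t]
    · rw [if_neg hsi, if_neg (by omega), mul_zero, zero_smul]
  rw [Finset.sum_congr rfl hl, Finset.sum_ite_eq' _ n, if_pos (by simp; omega)]

end IsRotatorBasis

end Rotator

/-! ### Comparison of `τ_y` with the Lusztig operators -/

section Comparison

variable {F : Type*} [Field F] {q : F} {V : Type*} [AddCommGroup V] [Module F V]
  {d : ℕ} {e f : Module.End F V} {K : (Module.End F V)ˣ} {v : ℕ → V}

/-- The rescaling by `θ^i q^(t i (d-i))` absorbs the parameters `θ` and `t`. -/
theorem IsWeightBasis.isRotatorBasis (hq : IsGeneric q) (h : IsWeightBasis q d e f K v) {θ : F}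
    (hθ : θ ≠ 0) (t : ℤ) {σ : UqEquitable q →ₐ[F] Module.End F V}
    (hx : σ (UqEquitable.x q) = ((K⁻¹ : (Module.End F V)ˣ) : Module.End F V) -
      (q ^ (1 + t) * (q - q⁻¹) * θ⁻¹) • (((K ^ (-1 - t) : (Module.End F V)ˣ) : Module.End F V) * e))
    (hy : σ (UqEquitable.y q : UqEquitable q) = K)
    (hz : σ (UqEquitable.z q) = ((K⁻¹ : (Module.End F V)ˣ) : Module.End F V) +
      (q ^ (-t) * (q - q⁻¹) * θ) • (f * ((K ^ t : (Module.End F V)ˣ) : Module.End F V))) :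
    IsRotatorBasis d σ fun i => (θ ^ (i : ℤ) * q ^ (t * i * ((d : ℤ) - i))) • v i := by
  have h0 := hq.ne_zero
  have h1 := hq.sub_inv_ne_zero
  have hnz : σ (UqEquitable.nz q) = (q ^ (2 + t) * θ⁻¹) •
      (((K ^ (-1 - t) : (Module.End F V)ˣ) : Module.End F V) * e * K) := by
    rw [UqEquitable.nz, map_smul, map_sub, map_one, map_mul, hx, hy, sub_mul, Units.inv_mul,
      sub_sub_cancel, smul_mul_assoc, smul_smul]
    congr 1
    rw [show 2 + t = (1 + t) + 1 by ring, zpow_add_one₀ h0, mul_assoc (q ^ (1 + t)), mul_left_comm,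
      ← mul_assoc (q / _), div_mul_cancel₀ _ h1, mul_assoc]
  have hnx : σ (UqEquitable.nx q) = (-(q ^ (1 - t) * θ)) •
      ((K : Module.End F V) * (f * ((K ^ t : (Module.End F V)ˣ) : Module.End F V))) := by
    rw [UqEquitable.nx, map_smul, map_sub, map_one, map_mul, hz, hy, mul_add, Units.mul_inv,
      sub_add_cancel_left, mul_smul_comm, smul_neg, smul_smul, ← neg_smul]
    congr 2
    rw [show 1 - t = -t + 1 by ring, zpow_add_one₀ h0, mul_assoc (q ^ (-t)), mul_left_comm,
      ← mul_assoc (q / _), div_mul_cancel₀ _ h1, mul_assoc]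
  refine ⟨fun i hi => by rw [h.eq_zero i hi, smul_zero], ?_, fun i => ?_, ?_, fun i => ?_,
    fun i => ?_⟩
  · refine eq_top_iff.2 (h.span ▸ Submodule.span_le.2 ?_)
    rintro _ ⟨i, rfl⟩
    have hc : θ ^ (i : ℤ) * q ^ (t * i * ((d : ℤ) - i)) ≠ 0 :=
      mul_ne_zero (zpow_ne_zero _ hθ) (zpow_ne_zero _ h0)
    rw [SetLike.mem_coe, ← Submodule.smul_mem_iff _ hc]
    exact Submodule.subset_span ⟨i, rfl⟩
  · rw [hy, map_smul, h.k, smul_comm]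
  · rw [hnz, map_smul, LinearMap.smul_apply, Module.End.mul_apply, h.k, map_smul,
      Module.End.mul_apply, h.e_zero]
    simp
  · rw [hnz, map_smul, LinearMap.smul_apply, Module.End.mul_apply, h.k, map_smul,
      Module.End.mul_apply, h.e_succ, map_smul, h.k_zpow h0, smul_smul, smul_smul, smul_smul,
      smul_smul, smul_smul]
    have e : q ^ (t * (i + 1 : ℕ) * ((d : ℤ) - (i + 1 : ℕ))) * q ^ (2 + t) *
        q ^ ((d : ℤ) - 2 * (i + 1 : ℕ)) * q ^ ((-1 - t) * ((d : ℤ) - 2 * i)) =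
        q ^ (t * i * ((d : ℤ) - i)) := by
      rw [← zpow_add₀ h0, ← zpow_add₀ h0, ← zpow_add₀ h0]
      congr 1; push_cast; ring
    rw [← e, Nat.cast_succ, zpow_add_one₀ hθ]
    congr 1
    field_simp
  · rw [hnx, map_smul, LinearMap.smul_apply, Module.End.mul_apply, Module.End.mul_apply,
      h.k_zpow h0, map_smul, h.f, map_smul, map_smul, h.k, smul_smul, smul_smul, smul_smul,
      smul_smul, smul_smul]
    have e : q ^ (t * i * ((d : ℤ) - i)) * q ^ (1 - t) * q ^ (t * ((d : ℤ) - 2 * i)) *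
        q ^ ((d : ℤ) - 2 * (i + 1 : ℕ)) =
        q ^ ((d : ℤ) - 1 - 2 * i) * q ^ (t * (i + 1 : ℕ) * ((d : ℤ) - (i + 1 : ℕ))) := by
      rw [← zpow_add₀ h0, ← zpow_add₀ h0, ← zpow_add₀ h0, ← zpow_add₀ h0]
      congr 1; push_cast; ring
    have e' : θ ^ ((i + 1 : ℕ) : ℤ) = θ ^ (i : ℤ) * θ := by
      rw [Nat.cast_succ, zpow_add_one₀ hθ]
    rw [e']
    congr 1
    linear_combination (-(θ ^ (i : ℤ) * θ * qInt q ((i : ℤ) + 1))) * e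

/-- In the original basis `τ_y` does not depend on `t`, as `i (d - i)` is symmetric under
`i ↔ d - i`. -/
theorem tauY_apply_of_isRotatorBasis (hq : IsGeneric q) {θ : F} (hθ : θ ≠ 0) (t : ℤ)
    {σ : UqEquitable q →ₐ[F] Module.End F V}
    (h : IsRotatorBasis d σ fun i => (θ ^ (i : ℤ) * q ^ (t * i * ((d : ℤ) - i))) • v i)
    {i n : ℕ} (hd : i + n = d) :
    tauY d σ (v i) = ((-1) ^ n * q ^ (intTri i + intTri n) * θ ^ ((n : ℤ) - i)) • v n := by
  have h0 := hq.ne_zero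
  have h1 := h.tauY_apply hq hd
  have hc : θ ^ (i : ℤ) * q ^ (t * i * ((d : ℤ) - i)) ≠ 0 :=
    mul_ne_zero (zpow_ne_zero _ hθ) (zpow_ne_zero _ h0)
  simp only [map_smul] at h1
  rw [← smul_right_inj hc, h1, smul_smul, smul_smul]
  congr 1
  rw [zpow_sub₀ hθ,
    show t * n * ((d : ℤ) - n) = t * i * ((d : ℤ) - i) by rw [← hd]; push_cast; ring]
  have := zpow_ne_zero (i : ℤ) hθ
  field_simp

theorem isUnit_of_antidiagonal [Module.Finite F V] (h0 : ∀ i, d < i → v i = 0)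
    (hs : Submodule.span F (Set.range v) = ⊤) {T : Module.End F V} {c : ℕ → ℕ → F}
    (hc : ∀ i n, c i n ≠ 0) (hT : ∀ i n, i + n = d → T (v i) = c i n • v n) : IsUnit T := by
  rw [LinearMap.isUnit_iff_range_eq_top, eq_top_iff, ← hs, Submodule.span_le]
  rintro _ ⟨n, rfl⟩
  rcases le_or_gt n d with hn | hn
  · refine ⟨(c (d - n) n)⁻¹ • v (d - n), ?_⟩
    rw [map_smul, hT (d - n) n (by omega), inv_smul_smul₀ (hc _ _)]
  · rw [h0 n hn]
    exact zero_mem _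

theorem eq_smul_inverse {A T : Module.End F V} {s : F} (hT : IsUnit T) (h : A * T = s • 1) :
    A = s • Ring.inverse T := by
  rw [← mul_one A, ← Ring.mul_inverse_cancel T hT, ← mul_assoc, h, smul_mul_assoc, one_mul]

/-- For `θ^2 = q`, the coefficient of `T` on `v i` times that of `τ_y` on `v n`. -/
theorem coeff_mul_of_sq_eq {θ : F} (hθ : θ ≠ 0) (hθq : θ ^ 2 = q) {i n : ℕ} (hd : i + n = d) :
    (-1) ^ n * q ^ ((n : ℤ) * (i + 1)) *
      ((-1) ^ i * q ^ (intTri n + intTri i) * θ ^ ((i : ℤ) - n)) = (-1) ^ d * θ ^ (d ^ 2) := by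
  have e : q ^ ((n : ℤ) * (i + 1)) * q ^ (intTri n + intTri i) * θ ^ ((i : ℤ) - n) =
      θ ^ (d ^ 2) := by
    have t1 := two_mul_intTri (i : ℤ)
    have t2 := two_mul_intTri (n : ℤ)
    rw [← hθq, ← zpow_natCast θ 2, ← zpow_natCast θ (d ^ 2), ← zpow_mul, ← zpow_mul,
      ← zpow_add₀ hθ, ← zpow_add₀ hθ, ← hd]
    congr 1
    push_cast
    linear_combination t1 + t2
  rw [← e, ← hd, pow_add]
  ring

/-- For `θ^2 = q⁻¹`, the coefficient of `T^∨` on `v i` times that of `τ_y` on `v n`. -/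
theorem coeff_mul_of_sq_eq_inv {θ : F} (hθ : θ ≠ 0) (hθq : θ ^ 2 = q⁻¹) {i n : ℕ}
    (hd : i + n = d) :
    (-1) ^ i * q ^ ((i : ℤ) * (n + 1)) *
      ((-1) ^ i * q ^ (intTri n + intTri i) * θ ^ ((i : ℤ) - n)) = θ ^ (-((d : ℤ) ^ 2)) := by
  have e : q ^ ((i : ℤ) * (n + 1)) * q ^ (intTri n + intTri i) * θ ^ ((i : ℤ) - n) =
      θ ^ (-((d : ℤ) ^ 2)) := by
    have t1 := two_mul_intTri (i : ℤ)
    have t2 := two_mul_intTri (n : ℤ)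
    rw [← inv_inv q, ← hθq, ← zpow_natCast θ 2, ← zpow_neg, ← zpow_mul, ← zpow_mul,
      ← zpow_add₀ hθ, ← zpow_add₀ hθ, ← hd]
    congr 1
    push_cast
    linear_combination -t1 - t2
  have s : (-1 : F) ^ i * (-1) ^ i = 1 := by rw [← mul_pow]; simp
  rw [← e]
  linear_combination (q ^ ((i : ℤ) * (n + 1)) * q ^ (intTri n + intTri i) * θ ^ ((i : ℤ) - n)) * s

theorem mul_eq_smul_one_of_antidiagonal (h0 : ∀ i, d < i → v i = 0)
    (hs : Submodule.span F (Set.range v) = ⊤) {A T : Module.End F V} {a c : ℕ → ℕ → F} {s : F}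
    (hA : ∀ i n, i + n = d → A (v i) = a i n • v n)
    (hT : ∀ i n, i + n = d → T (v i) = c i n • v n)
    (hac : ∀ i n, i + n = d → c i n * a n i = s) : A * T = s • 1 :=
  ext_of_span h0 hs fun i n hd => by
    rw [Module.End.mul_apply, hT i n hd, map_smul, hA n i (by omega), smul_smul, hac i n hd,
      LinearMap.smul_apply, Module.End.one_apply]

/-- The standard basis of a copy of `V_d`, extended by zero. -/
theorem isWeightBasis_stdVec (hq : IsGeneric q) (d : ℕ) {ρ : Uq q →ₐ[F] Module.End F V}
    (φ : V ≃ₗ[F] (Fin (d + 1) → F)) (hφ : ∀ (u : Uq q) (v : V), φ (ρ u v) = vd hq d u (φ v)) :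
    IsWeightBasis q d (ρ (Uq.e q)) (ρ (Uq.f q)) (Units.map (ρ : Uq q →* Module.End F V) (Uq.k q))
      (fun i => if h : i < d + 1 then φ.symm (stdVec F d ⟨i, h⟩) else 0) where
  eq_zero i hi := dif_neg (by omega)
  span := by
    have h1 : Submodule.span F (Set.range fun i : Fin (d + 1) => φ.symm (stdVec F d i)) = ⊤ := by
      have := ((Pi.basisFun F (Fin (d + 1))).map φ.symm).span_eq
      rwa [Module.Basis.coe_map, show ⇑(Pi.basisFun F (Fin (d + 1))) = stdVec F d from
        funext fun i => by simp [stdVec]] at this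
    refine eq_top_iff.2 (h1 ▸ Submodule.span_mono ?_)
    rintro _ ⟨i, rfl⟩
    exact ⟨i, dif_pos i.isLt⟩
  k i := by
    split_ifs with h
    · refine φ.injective ?_
      refine (hφ _ _).trans ?_
      rw [vd, Uq.lift_k, map_smul, LinearEquiv.apply_symm_apply]
      refine (vK_apply q d 1 _).trans ?_
      rw [one_mul]
    · simp
  e_zero := by
    rw [dif_pos (by omega)]
    refine φ.injective ?_
    rw [hφ, vd, Uq.lift_e, LinearEquiv.apply_symm_apply, vE_apply, if_neg (by simp), map_zero]
  e_succ i := by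
    by_cases h : i + 1 < d + 1
    · rw [dif_pos h, dif_pos (by omega)]
      refine φ.injective ?_
      rw [hφ, vd, Uq.lift_e, LinearEquiv.apply_symm_apply, vE_apply, if_pos (by simp), map_smul,
        LinearEquiv.apply_symm_apply, show (d : ℤ) - (i + 1 : ℕ) + 1 = d - i by push_cast; ring]
      rfl
    · rw [dif_neg h, map_zero]
      split_ifs with h2
      · rw [show (d : ℤ) - i = 0 by omega, qInt_zero, zero_smul]
      · simp
  f i := by
    by_cases h : i < d + 1
    · rw [dif_pos h]
      refine φ.injective ?_
      rw [hφ, vd, Uq.lift_f, LinearEquiv.apply_symm_apply, vF_apply]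
      by_cases h2 : i < d
      · rw [dif_pos h2, dif_pos (by omega), map_smul, LinearEquiv.apply_symm_apply]
      · rw [dif_neg h2, dif_neg (by omega), smul_zero, map_zero]
    · rw [dif_neg h, dif_neg (by omega), map_zero, smul_zero]

theorem IsWeightBasis.isRotatorBasis_primary (hq : IsGeneric q) {ρ : Uq q →ₐ[F] Module.End F V}
    (h : IsWeightBasis q d (ρ (Uq.e q)) (ρ (Uq.f q))
      (Units.map (ρ : Uq q →* Module.End F V) (Uq.k q)) v) {θ : F} (hθ : θ ≠ 0) (t : ℤ) :
    IsRotatorBasis d (ρ.comp (primary hq hθ t : UqEquitable q →ₐ[F] Uq q))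
      fun i => (θ ^ (i : ℤ) * q ^ (t * i * ((d : ℤ) - i))) • v i := by
  have hk : ρ (Uq.k q : Uq q) =
    ((Units.map (ρ : Uq q →* Module.End F V) (Uq.k q) : (Module.End F V)ˣ) : Module.End F V) := rfl
  refine h.isRotatorBasis hq hθ t ?_ ?_ ?_
  · refine (congrArg ρ (UqEquitable.lift_x _)).trans ?_
    rw [map_sub, map_smul, map_mul, map_units_zpow ρ hk, map_units_inv ρ hk]
  · exact congrArg ρ (UqEquitable.lift_y _)
  · refine (congrArg ρ (UqEquitable.lift_z _)).trans ?_
    rw [map_add, map_smul, map_mul, map_units_zpow ρ hk, map_units_inv ρ hk]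

/-- The secondary identification is the primary one for `f`, `e`, `k⁻¹` instead of `e`, `f`, `k`. -/
theorem IsWeightBasis.isRotatorBasis_secondary (hq : IsGeneric q)
    {ρ : Uq q →ₐ[F] Module.End F V}
    (h : IsWeightBasis q d (ρ (Uq.f q)) (ρ (Uq.e q))
      (Units.map (ρ : Uq q →* Module.End F V) (Uq.k q))⁻¹ v) {θ : F} (hθ : θ ≠ 0) (t : ℤ) :
    IsRotatorBasis d (ρ.comp (secondary hq hθ t : UqEquitable q →ₐ[F] Uq q))
      fun i => (θ ^ (i : ℤ) * q ^ (t * i * ((d : ℤ) - i))) • v i := by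
  have hk : ρ (Uq.k q : Uq q) =
    ((Units.map (ρ : Uq q →* Module.End F V) (Uq.k q) : (Module.End F V)ˣ) : Module.End F V) := rfl
  refine h.isRotatorBasis hq hθ t ?_ ?_ ?_
  · refine (congrArg ρ (UqEquitable.lift_x _)).trans ?_
    rw [map_sub, map_smul, map_mul, map_units_zpow ρ hk, hk, inv_inv, inv_zpow',
      show -(-1 - t) = 1 + t by ring]
  · exact (congrArg ρ (UqEquitable.lift_y _)).trans (map_units_inv ρ hk)
  · refine (congrArg ρ (UqEquitable.lift_z _)).trans ?_
    rw [map_add, map_smul, map_mul, map_units_zpow ρ hk, hk, inv_inv, inv_zpow']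

end Comparison
end QuantumSl2

open QuantumSl2 in
theorem proposition9 {F : Type*} [Field F] {q : F} (hq : IsGeneric q) (d : ℕ)
    {V : Type*} [AddCommGroup V] [Module F V] (ρ : Uq q →ₐ[F] Module.End F V)
    (φ : V ≃ₗ[F] (Fin (d + 1) → F)) (hφ : ∀ (u : Uq q) (v : V), φ (ρ u v) = vd hq d u (φ v))
    {θ : F} (hθ : θ ≠ 0) (t : ℤ) :
    IsUnit (lusztigT ρ) ∧ IsUnit (lusztigTVee ρ) ∧
    (θ ^ 2 = q →
      tauY d (ρ.comp (primary hq hθ t : UqEquitable q →ₐ[F] Uq q)) =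
        ((-1) ^ d * θ ^ (d ^ 2)) • Ring.inverse (lusztigT ρ) ∧
      tauY d (ρ.comp (secondary hq hθ t : UqEquitable q →ₐ[F] Uq q)) =
        ((-1) ^ d * θ ^ (d ^ 2)) • Ring.inverse (lusztigTVee ρ)) ∧
    (θ ^ 2 = q⁻¹ →
      tauY d (ρ.comp (primary hq hθ t : UqEquitable q →ₐ[F] Uq q)) =
        θ ^ (-((d : ℤ) ^ 2)) • Ring.inverse (lusztigTVee ρ) ∧
      tauY d (ρ.comp (secondary hq hθ t : UqEquitable q →ₐ[F] Uq q)) =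
        θ ^ (-((d : ℤ) ^ 2)) • Ring.inverse (lusztigT ρ)) := by
  have h0 := hq.ne_zero
  obtain ⟨v, h⟩ : ∃ v : ℕ → V, IsWeightBasis q d (ρ (Uq.e q)) (ρ (Uq.f q))
      (Units.map (ρ : Uq q →* Module.End F V) (Uq.k q)) v := ⟨_, isWeightBasis_stdVec hq d φ hφ⟩
  -- The reversed basis, for the two statements about the secondary identification.
  obtain ⟨u, hu, hs⟩ : ∃ u : ℕ → V, (∀ i n, i + n = d → u i = v n) ∧
      IsWeightBasis q d (ρ (Uq.f q)) (ρ (Uq.e q))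
        (Units.map (ρ : Uq q →* Module.End F V) (Uq.k q))⁻¹ u :=
    ⟨_, fun i n hd => by rw [if_pos (by omega), show d - i = n by omega], h.swap h0⟩
  have hp := h.isRotatorBasis_primary hq hθ t
  have hsec := hs.isRotatorBasis_secondary hq hθ t
  have hT := fun i n (hd : i + n = d) => lusztigT_apply hq h hd
  have hT' := fun i n (hd : i + n = d) => lusztigTVee_apply hq h hd
  have hTu : ∀ i n, i + n = d → lusztigT ρ (u i) = ((-1) ^ i * q ^ ((i : ℤ) * (n + 1))) • u n :=
    fun i n hd => by rw [hu i n hd, hu n i (by omega), hT n i (by omega)]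
  have hTu' : ∀ i n, i + n = d →
      lusztigTVee ρ (u i) = ((-1) ^ n * q ^ ((n : ℤ) * (i + 1))) • u n :=
    fun i n hd => by rw [hu i n hd, hu n i (by omega), hT' n i (by omega)]
  have hτ := fun i n (hd : i + n = d) => tauY_apply_of_isRotatorBasis hq hθ t hp hd
  have hτ' := fun i n (hd : i + n = d) => tauY_apply_of_isRotatorBasis hq hθ t hsec hd
  have : Module.Finite F V := Module.Finite.equiv φ.symm
  have hne : (-1 : F) ≠ 0 := neg_ne_zero.2 one_ne_zero
  have U := isUnit_of_antidiagonal h.eq_zero h.span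
    (fun i n => mul_ne_zero (pow_ne_zero _ hne) (zpow_ne_zero _ h0)) hT
  have U' := isUnit_of_antidiagonal h.eq_zero h.span
    (fun i n => mul_ne_zero (pow_ne_zero _ hne) (zpow_ne_zero _ h0)) hT'
  refine ⟨U, U', fun hθq => ⟨eq_smul_inverse U ?_, eq_smul_inverse U' ?_⟩,
    fun hθq => ⟨eq_smul_inverse U' ?_, eq_smul_inverse U ?_⟩⟩
  · exact mul_eq_smul_one_of_antidiagonal h.eq_zero h.span hτ hT
      fun i n hd => coeff_mul_of_sq_eq hθ hθq hd
  · exact mul_eq_smul_one_of_antidiagonal hs.eq_zero hs.span hτ' hTu'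
      fun i n hd => coeff_mul_of_sq_eq hθ hθq hd
  · exact mul_eq_smul_one_of_antidiagonal h.eq_zero h.span hτ hT'
      fun i n hd => coeff_mul_of_sq_eq_inv hθ hθq hd
  · exact mul_eq_smul_one_of_antidiagonal hs.eq_zero hs.span hτ' hTu
      fun i n hd => coeff_mul_of_sq_eq_inv hθ hθq hd
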